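/- Let $Q(x,y,z)$ be a positive definite real quadratic form and let $d\ge 1$. Write $\mathbb{R}^{3\circ}=\mathbb{R}^3\setminus\{0\}$ for the space of nonzero real linear forms $L=ax+by+cz$ (identified with their coefficient vectors). Define the following spaces, each with the quotient topology. * The real multipole space $\mathcal{M}^{\mathbb{R}}(d)=(\mathbb{R}^{3\circ})^d/\Sigma_d^{\mathbb{R}}$, where $\Sigma_d^{\mathbb{R}}$ is the group generated by the permutations of the $d$ factors and the rescalings $(L_j)\mapsto(c_jL_j)$ with $c_j\in\mathbb{R}^*$, $\prod_j c_j=1$. * The symmetric power $\mathrm{Sym}^d(\mathbb{R}P^2)=(\mathbb{R}P^2)^d/S_d$, where $\mathbb{R}P^2=\mathbb{R}^{3\circ}/\mathbb{R}^*$. The group $\mathbb{R}^*$ acts on $\mathcal{M}^{\mathbb{R}}(d)$ by multiplying one of the forms, and $\mathcal{M}^{\mathbb{R}}(d)/\mathbb{R}^*=\mathrm{Sym}^d(\mathbb{R}P^2)$. * The coned multipole space $\overline{\mathcal{M}}^{\mathbb{R}}(d)$, obtained from the line bundle $\mathcal{M}^{\mathbb{R}}(d)\times_{\mathbb{R}^*}\mathbb{R}\to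 \mathrm{Sym}^d(\mathbb{R}P^2)$ by collapsing its zero section to a point. The smooth structures are as follows. For a $Q$-orthonormal basis $v=(v_0,v_1,v_2)$ of $\mathbb{R}^3$ let $\alpha(u)=(u^2-1)v_0-\mathrm{i}(u^2+1)v_1+2uv_2$, $u\in\mathbb{C}$, which parametrizes the complex conic $\{Q=0\}$. A real linear form $L$ with $L(v_2)\ne 0$ satisfies $L(\alpha(u))=\nu\,(u-w)(1+\bar w u)$ for unique $\nu=\nu_v(L)\in\mathbb{R}^*$ and $w=w_v(L)\in\mathbb{C}$ with $|w|<1$, and $w_v$ is a local complex coordinate on $\mathbb{R}P^2$. The charts of $\mathrm{Sym}^d(\mathbb{R}P^2)$ are, for all such $v$, the maps sending $[L_1,\dots,L_d]$ with all $L_j(v_2)\neq 0$ to the non-leading coefficients, in $\mathbb{C}^d$, of $\prod_j (X-w_v(L_j))$; the charts of $\mathcal{M}^{\mathbb{R}}(d)$ are given by these coefficients together with $\prod_j\nu_v(L_j)\in\mathbb{R}$. The space $\mathbb{R}P^{2d}$ carries its standard affine charts. Then these charts make $\mathcal{M}^{\mathbb{R}}(d)$ and $\mathrm{Sym}^d(\mathbb{R}P^2)$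 smooth manifolds, and 1. $\mathcal{M}^{\mathbb{R}}(d)$ is diffeomorphic to $\mathbb{R}^{2d+1}\setminus\{0\}$, and hence to $S^{2d}\times\mathbb{R}$; 2. $\overline{\mathcal{M}}^{\mathbb{R}}(d)$ is homeomorphic to $\mathbb{R}^{2d+1}$; 3. $\mathrm{Sym}^d(\mathbb{R}P^2)$ is diffeomorphic to $\mathbb{R}P^{2d}$. -/

import Mathlib

open scoped Manifold ContDiff LinearAlgebra.Projectivization

noncomputable section

/-! ### Projective spaces -/

/-- The quotient topology on the projectivization of a real topological vector space. -/
instance Projectivization.instTopologicalSpaceReal (V : Type*) [AddCommGroup V] [Module ℝ V]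
    [TopologicalSpace V] : TopologicalSpace (ℙ ℝ V) :=
  inferInstanceAs (TopologicalSpace (Quotient (projectivizationSetoid ℝ V)))

/-- Real projective space `ℝPⁿ`, the space of lines through the origin in `ℝⁿ⁺¹`. -/
abbrev RealProj (n : ℕ) : Type := ℙ ℝ (Fin (n + 1) → ℝ)

namespace RealProj

/-- The set of points `[x₀ : … : xₙ]` with `xᵢ ≠ 0`. -/
def affineDomain {n : ℕ} (i : Fin (n + 1)) : Set (RealProj n) :=
  {p | p.rep i ≠ 0}

/-- The affine coordinates `[x₀ : … : xₙ] ↦ (xⱼ / xᵢ)` with `j ≠ i`. -/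
def affineCoord {n : ℕ} (i : Fin (n + 1)) : RealProj n → (Fin n → ℝ) :=
  Projectivization.lift (fun x j => x.1 (i.succAbove j) / x.1 i) (by
    rintro ⟨a, ha⟩ ⟨b, hb⟩ t rfl
    have ht : t ≠ 0 := by
      rintro rfl
      simp at ha
    funext j
    simp [mul_div_mul_left _ _ ht])

/-- The standard atlas of `ℝPⁿ`: the affine charts. -/
def stdAtlas (n : ℕ) : Set (OpenPartialHomeomorph (RealProj n) (Fin n → ℝ)) :=
  {φ | ∃ i : Fin (n + 1), φ.source = affineDomain i ∧ Set.EqOn φ (affineCoord i) φ.source}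

end RealProj

/-! ### Symmetric powers and multipole spaces as topological spaces -/

/-- Two `d`-tuples are equivalent when they differ by a permutation. -/
def symPowerSetoid (X : Type*) (d : ℕ) : Setoid (Fin d → X) where
  r x y := ∃ σ : Equiv.Perm (Fin d), y = x ∘ σ
  iseqv :=
    { refl := fun x => ⟨1, rfl⟩
      symm := by
        rintro x y ⟨σ, rfl⟩
        exact ⟨σ⁻¹, by funext i; simp⟩
      trans := by
        rintro x y z ⟨σ, rfl⟩ ⟨τ, rfl⟩
        exact ⟨σ * τ, rfl⟩ }

/-- The symmetric power `Symᵈ(X) = Xᵈ / S_d`. -/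
def SymPower (X : Type*) (d : ℕ) : Type _ := Quotient (symPowerSetoid X d)

instance SymPower.instTopologicalSpace (X : Type*) [TopologicalSpace X] (d : ℕ) :
    TopologicalSpace (SymPower X d) :=
  inferInstanceAs (TopologicalSpace (Quotient (symPowerSetoid X d)))

/-- A nonzero linear form `a x + b y + c z`, given by its vector of coefficients. -/
abbrev LinForm : Type := {L : Fin 3 → ℝ // L ≠ 0}

/-- Multiplication of a nonzero linear form by a nonzero scalar. -/
def LinForm.scale (t : ℝˣ) (L : LinForm) : LinForm :=
  ⟨(t : ℝ) • L.1, smul_ne_zero t.ne_zero L.2⟩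

theorem LinForm.scale_one (L : LinForm) : LinForm.scale 1 L = L := by
  apply Subtype.ext
  simp [LinForm.scale]

theorem LinForm.scale_scale (s t : ℝˣ) (L : LinForm) :
    LinForm.scale s (LinForm.scale t L) = LinForm.scale (s * t) L := by
  apply Subtype.ext
  simp [LinForm.scale, mul_smul]

/-- The orbit relation on `d`-tuples of nonzero linear forms of the group generated by the
permutations of the factors and the rescalings `(L_j) ↦ (c_j L_j)` with `∏ c_j = 1`. -/
def multipoleSetoid (d : ℕ) : Setoid (Fin d → LinForm) where
  r L M := ∃ (σ : Equiv.Perm (Fin d)) (c : Fin d → ℝˣ), ∏ j, c j = 1 ∧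
    ∀ j, M j = LinForm.scale (c j) (L (σ j))
  iseqv :=
    { refl := fun L => ⟨1, 1, by simp, fun j => (LinForm.scale_one _).symm⟩
      symm := by
        rintro L M ⟨σ, c, hc, h⟩
        refine ⟨σ⁻¹, fun j => (c (σ⁻¹ j))⁻¹, ?_, fun j => ?_⟩
        · rw [Equiv.prod_comp σ⁻¹ fun j => (c j)⁻¹, Finset.prod_inv_distrib, hc, inv_one]
        · rw [h, LinForm.scale_scale, inv_mul_cancel, LinForm.scale_one]
          simp
      trans := by
        rintro L M N ⟨σ, c, hc, h⟩ ⟨τ, b, hb, k⟩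
        refine ⟨σ * τ, fun j => b j * c (τ j), ?_, fun j => ?_⟩
        · rw [Finset.prod_mul_distrib, hb, Equiv.prod_comp τ c, hc, one_mul]
        · rw [k, h, LinForm.scale_scale]
          rfl }

/-- The real multipole space: unordered `d`-tuples of nonzero linear forms, up to rescalings
of the forms with product one. -/
def MultipoleSpace (d : ℕ) : Type := Quotient (multipoleSetoid d)

instance MultipoleSpace.instTopologicalSpace (d : ℕ) : TopologicalSpace (MultipoleSpace d) :=
  inferInstanceAs (TopologicalSpace (Quotient (multipoleSetoid d)))

/-- The multipole represented by a tuple of nonzero linear forms. -/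
def MultipoleSpace.mk {d : ℕ} (L : Fin d → LinForm) : MultipoleSpace d :=
  Quotient.mk (multipoleSetoid d) L

/-- The identifications `(t · m, s) ∼ (m, t s)`, for `t ∈ ℝ^*`, on pairs of a multipole and a
real number. Here `t` multiplies a multipole by rescaling its forms by any nonzero numbers whose
product is `t`. -/
def multipoleLineSetoid (d : ℕ) : Setoid (MultipoleSpace d × ℝ) where
  r p q := ∃ (L : Fin d → LinForm) (c : Fin d → ℝˣ), p.1 = MultipoleSpace.mk L ∧
    q.1 = MultipoleSpace.mk (fun j => LinForm.scale (c j) (L j)) ∧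
    p.2 = ((∏ j, c j : ℝˣ) : ℝ) * q.2
  iseqv :=
    { refl := by
        rintro ⟨m, s⟩
        induction m using Quotient.inductionOn with
        | h L => exact ⟨L, 1, rfl, by simp [LinForm.scale_one]; rfl, by simp⟩
      symm := by
        rintro ⟨m, s⟩ ⟨n, t⟩ ⟨L, c, hm, hn, hs⟩
        refine ⟨fun j => LinForm.scale (c j) (L j), c⁻¹, hn, ?_, ?_⟩
        · simpa [LinForm.scale_scale, LinForm.scale_one] using hm
        · simp only at hs
          rw [hs, ← mul_assoc, ← Units.val_mul, ← Finset.prod_mul_distrib]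
          simp
      trans := by
        rintro ⟨m, s⟩ ⟨n, t⟩ ⟨o, u⟩ ⟨L, c, hm, hn, hs⟩ ⟨M, b, hn', ho, ht⟩
        obtain ⟨σ, a, ha, h⟩ : (multipoleSetoid d).r (fun j => LinForm.scale (c j) (L j)) M :=
          Quotient.exact (hn.symm.trans hn')
        simp only at hm hn ho hs ht
        refine ⟨L, fun j => b (σ⁻¹ j) * c j, hm, ?_, ?_⟩
        · rw [ho]
          refine Quotient.sound ?_
          change (multipoleSetoid d).r _ _
          refine ⟨σ⁻¹, fun j => (a (σ⁻¹ j))⁻¹, ?_, fun j => ?_⟩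
          · rw [Equiv.prod_comp σ⁻¹ fun j => (a j)⁻¹, Finset.prod_inv_distrib, ha, inv_one]
          · simp only [h, LinForm.scale_scale]
            rw [show σ (σ⁻¹ j) = j by simp]
            congr 1
            rw [mul_comm (b (σ⁻¹ j)) (a (σ⁻¹ j) * c j), ← mul_assoc, ← mul_assoc,
              inv_mul_cancel, one_mul, mul_comm]
        · rw [hs, ht, Finset.prod_mul_distrib, Equiv.prod_comp σ⁻¹ b, ← mul_assoc]
          push_cast
          ring }

/-- The total space `M ×_{ℝ^*} ℝ` of the line bundle over the symmetric power of `ℝP²` that is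
associated with the principal `ℝ^*`-bundle given by the multipole space `M`. -/
def MultipoleLineBundle (d : ℕ) : Type := Quotient (multipoleLineSetoid d)

instance MultipoleLineBundle.instTopologicalSpace (d : ℕ) :
    TopologicalSpace (MultipoleLineBundle d) :=
  inferInstanceAs (TopologicalSpace (Quotient (multipoleLineSetoid d)))

/-- The zero section of the line bundle. -/
def MultipoleLineBundle.zeroSection (d : ℕ) : Set (MultipoleLineBundle d) :=
  {x | ∃ m : MultipoleSpace d, x = Quotient.mk (multipoleLineSetoid d) (m, 0)}

/-- Two points of the line bundle are equivalent if they are equal or both on the zero section. -/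
def conedSetoid (d : ℕ) : Setoid (MultipoleLineBundle d) where
  r x y := x = y ∨
    (x ∈ MultipoleLineBundle.zeroSection d ∧ y ∈ MultipoleLineBundle.zeroSection d)
  iseqv :=
    { refl := fun x => Or.inl rfl
      symm := by
        rintro x y (h | ⟨h, k⟩)
        · exact Or.inl h.symm
        · exact Or.inr ⟨k, h⟩
      trans := by
        rintro x y z (rfl | ⟨h, k⟩) (rfl | ⟨h', k'⟩)
        · exact Or.inl rfl
        · exact Or.inr ⟨h', k'⟩
        · exact Or.inr ⟨h, k⟩
        · exact Or.inr ⟨h, k'⟩ }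

/-- The coned multipole space: the line bundle with its zero section collapsed to a point. -/
def ConedMultipoleSpace (d : ℕ) : Type := Quotient (conedSetoid d)

instance ConedMultipoleSpace.instTopologicalSpace (d : ℕ) :
    TopologicalSpace (ConedMultipoleSpace d) :=
  inferInstanceAs (TopologicalSpace (Quotient (conedSetoid d)))

/-! ### Smooth structures

For a positive definite form `Q`, a point of `ℝP²`, that is, a linear form `L` up to scaling, is a
pair of complex conjugate points of the complex conic `Q = 0`, which is a Riemann sphere. So `ℝP²`
has local complex coordinates, well defined up to holomorphic and antiholomorphic changes of
coordinates, and the coefficients of `∏ (X - w_j)` are smooth coordinates on the symmetric power.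

Explicitly, let `v` be a `Q`-orthonormal basis of the `(x, y, z)`-space. The conic is
parametrized by `α(u) = (u² - 1) v₀ - i (u² + 1) v₁ + 2 u v₂`, and a linear form `L` with
`L(v₂) ≠ 0` satisfies `L(α(u)) = ν (u - w) (1 + w̄ u)`, where the real number `ν ≠ 0` and the complex
number `w` of modulus less than one are the ones defined below. -/

/-- `v` is an orthonormal basis for `Q`. -/
def IsOrthonormalFrame (Q : QuadraticForm ℝ (Fin 3 → ℝ)) (v : Fin 3 → (Fin 3 → ℝ)) : Prop :=
  (∀ i, Q (v i) = 1) ∧ ∀ i j, i ≠ j → QuadraticMap.IsOrtho Q (v i) (v j)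

/-- The value of the linear form with coefficients `L` on the `i`-th vector of the frame. -/
def frameValue (v : Fin 3 → (Fin 3 → ℝ)) (i : Fin 3) (L : Fin 3 → ℝ) : ℝ := L ⬝ᵥ v i

/-- The scalar coordinate `ν = ℓ₂ + sgn(ℓ₂) |ℓ|` of a linear form with values `ℓ` on the frame. -/
def conicScale (v : Fin 3 → (Fin 3 → ℝ)) (L : Fin 3 → ℝ) : ℝ :=
  frameValue v 2 L + Real.sign (frameValue v 2 L) *
    Real.sqrt (frameValue v 0 L ^ 2 + frameValue v 1 L ^ 2 + frameValue v 2 L ^ 2)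

/-- The complex coordinate `w = (ℓ₀ + i ℓ₁) / ν` of a linear form with values `ℓ` on the frame. -/
def conicCoord (v : Fin 3 → (Fin 3 → ℝ)) (L : Fin 3 → ℝ) : ℂ :=
  ((frameValue v 0 L : ℂ) + Complex.I * (frameValue v 1 L : ℂ)) / (conicScale v L : ℂ)

theorem frameValue_smul (v : Fin 3 → (Fin 3 → ℝ)) (i : Fin 3) (t : ℝ) (L : Fin 3 → ℝ) :
    frameValue v i (t • L) = t * frameValue v i L := by
  simp [frameValue]

theorem conicScale_smul (v : Fin 3 → (Fin 3 → ℝ)) {t : ℝ} (ht : t ≠ 0) (L : Fin 3 → ℝ) :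
    conicScale v (t • L) = t * conicScale v L := by
  have hs : Real.sqrt ((t * frameValue v 0 L) ^ 2 + (t * frameValue v 1 L) ^ 2 +
      (t * frameValue v 2 L) ^ 2) = |t| *
      Real.sqrt (frameValue v 0 L ^ 2 + frameValue v 1 L ^ 2 + frameValue v 2 L ^ 2) := by
    rw [← Real.sqrt_sq_eq_abs, ← Real.sqrt_mul (sq_nonneg t)]
    congr 1
    ring
  have hsign : Real.sign (t * frameValue v 2 L) * |t| = t * Real.sign (frameValue v 2 L) := by
    have h : Real.sign (t * frameValue v 2 L) = Real.sign t * Real.sign (frameValue v 2 L) := by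
      rcases lt_trichotomy t 0 with h1 | h1 | h1 <;>
      rcases lt_trichotomy (frameValue v 2 L) 0 with h2 | h2 | h2 <;>
      simp [h1, h2, Real.sign_of_neg, Real.sign_of_pos, mul_pos_of_neg_of_neg,
        mul_neg_of_neg_of_pos, mul_neg_of_pos_of_neg]
    rw [h, mul_right_comm]
    congr 1
    rcases lt_or_gt_of_ne ht with h1 | h1
    · simp [Real.sign_of_neg h1, abs_of_neg h1]
    · simp [Real.sign_of_pos h1, abs_of_pos h1]
  simp only [conicScale, frameValue_smul]
  rw [hs, ← mul_assoc, hsign]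
  ring

theorem conicCoord_smul (v : Fin 3 → (Fin 3 → ℝ)) {t : ℝ} (ht : t ≠ 0) (L : Fin 3 → ℝ) :
    conicCoord v (t • L) = conicCoord v L := by
  have ht' : (t : ℂ) ≠ 0 := by exact_mod_cast ht
  simp only [conicCoord, frameValue_smul, conicScale_smul v ht]
  push_cast
  rw [← mul_div_mul_left ((frameValue v 0 L : ℂ) + Complex.I * (frameValue v 1 L : ℂ)) _ ht']
  congr 1
  ring

/-- The complex coordinate as a function on `ℝP²`. -/
def projConicCoord (v : Fin 3 → (Fin 3 → ℝ)) : RealProj 2 → ℂ :=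
  Projectivization.lift (fun L => conicCoord v L.1) (by
    rintro ⟨a, ha⟩ ⟨b, hb⟩ t rfl
    have ht : t ≠ 0 := by
      rintro rfl
      simp at ha
    exact conicCoord_smul v ht b)

/-- The coefficients of `1, X, …, X^{d-1}` in the monic polynomial with roots `w`; up to sign they
are the elementary symmetric functions of `w`. -/
def rootCoeffs {d : ℕ} (w : Fin d → ℂ) : Fin d → ℂ :=
  fun k => (∏ j, (Polynomial.X - Polynomial.C (w j))).coeff k

theorem rootCoeffs_comp {d : ℕ} (w : Fin d → ℂ) (σ : Equiv.Perm (Fin d)) :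
    rootCoeffs (w ∘ σ) = rootCoeffs w := by
  funext k
  simp only [rootCoeffs, Function.comp_apply]
  rw [Equiv.prod_comp σ fun j => Polynomial.X - Polynomial.C (w j)]

namespace SymPower

/-- The unordered `d`-tuples of points of `ℝP²` that avoid the line `L(v₂) = 0`. -/
def chartDomain (v : Fin 3 → (Fin 3 → ℝ)) (d : ℕ) : Set (SymPower (RealProj 2) d) :=
  {x | ∃ p : Fin d → RealProj 2, x = Quotient.mk (symPowerSetoid _ d) p ∧
    ∀ j, frameValue v 2 (p j).rep ≠ 0}

/-- The elementary symmetric functions of the complex coordinates of `d` points of `ℝP²`. -/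
def chartCoord (v : Fin 3 → (Fin 3 → ℝ)) (d : ℕ) : SymPower (RealProj 2) d → (Fin d → ℂ) :=
  Quotient.lift (fun p => rootCoeffs fun j => projConicCoord v (p j)) (by
    rintro p q ⟨σ, rfl⟩
    exact (rootCoeffs_comp (fun j => projConicCoord v (p j)) σ).symm)

/-- The atlas of the symmetric power of `ℝP²` defined by a positive definite form. -/
def conicAtlas (Q : QuadraticForm ℝ (Fin 3 → ℝ)) (d : ℕ) :
    Set (OpenPartialHomeomorph (SymPower (RealProj 2) d) (Fin d → ℂ)) :=
  {φ | ∃ v, IsOrthonormalFrame Q v ∧ φ.source = chartDomain v d ∧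
    Set.EqOn φ (chartCoord v d) φ.source}

end SymPower

namespace MultipoleSpace

/-- The multipoles all of whose linear forms satisfy `L(v₂) ≠ 0`. -/
def chartDomain (v : Fin 3 → (Fin 3 → ℝ)) (d : ℕ) : Set (MultipoleSpace d) :=
  {m | ∃ L : Fin d → LinForm, m = mk L ∧ ∀ j, frameValue v 2 (L j).1 ≠ 0}

/-- The elementary symmetric functions of the complex coordinates of the forms of a multipole,
together with the product of their scalar coordinates (the coordinate along the fibre of the
bundle over the symmetric power of `ℝP²`). -/
def chartCoord (v : Fin 3 → (Fin 3 → ℝ)) (d : ℕ) : MultipoleSpace d → (Fin d → ℂ) × ℝ :=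
  Quotient.lift
    (fun L => (rootCoeffs fun j => conicCoord v (L j).1, ∏ j, conicScale v (L j).1)) (by
    rintro L M ⟨σ, c, hc, h⟩
    have hw : (fun j => conicCoord v (M j).1) = (fun j => conicCoord v (L j).1) ∘ σ := by
      funext j
      rw [h]
      exact conicCoord_smul v (c j).ne_zero _
    have hn : ∏ j, conicScale v (M j).1 = ∏ j, conicScale v (L j).1 := by
      have h1 : ∀ j, conicScale v (M j).1 = (c j : ℝ) * conicScale v (L (σ j)).1 := fun j => by
        rw [h]
        exact conicScale_smul v (c j).ne_zero _
      have hc' : ∏ j, (c j : ℝ) = 1 := by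
        rw [← Units.coe_prod, hc, Units.val_one]
      simp only [h1]
      rw [Finset.prod_mul_distrib, hc', one_mul,
        Equiv.prod_comp σ fun j => conicScale v (L j).1]
    simp only [hw, hn, rootCoeffs_comp])

/-- The atlas of the multipole space defined by a positive definite form. -/
def conicAtlas (Q : QuadraticForm ℝ (Fin 3 → ℝ)) (d : ℕ) :
    Set (OpenPartialHomeomorph (MultipoleSpace d) ((Fin d → ℂ) × ℝ)) :=
  {φ | ∃ v, IsOrthonormalFrame Q v ∧ φ.source = chartDomain v d ∧
    Set.EqOn φ (chartCoord v d) φ.source}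

end MultipoleSpace

/-- The vector space `ℝⁿ` with the origin removed, as an open submanifold. -/
def puncturedSpace (n : ℕ) : TopologicalSpace.Opens (EuclideanSpace ℝ (Fin n)) :=
  ⟨{0}ᶜ, isOpen_compl_singleton⟩

end

noncomputable section

open Polynomial ComplexConjugate

/-! ### Conjugate-reciprocal polynomials -/

/-! Restricted to the conic `Q = 0`, parametrized by `α`, a real linear form becomes a quadratic
polynomial in `u` that is real for the structure induced by the antipode `u ↦ -1 / conj u`. A
product of `d` forms becomes an antipodally real polynomial of degree at most `2d`, and these
polynomials form a real vector space of dimension `2d + 1`. The roots of such a polynomial come in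
antipodal pairs (with `0` paired to `∞`), and each pair is the zero set of one real form up to
scaling. By the fundamental theorem of algebra, every nonzero antipodally real polynomial is
therefore a product of `d` real forms, unique up to order and rescalings with product one
(`IsAntipodalReal.exists_eq_prod`, `multipoleMap_injective`). So `multipoleMap` is an
`ℝˣ`-equivariant bijection from the multipole space onto a punctured vector space. Coning it off
gives the full vector space; dividing by `ℝˣ` gives its projectivization.

Topology: a product of unit forms times a scalar defines a proper map `coneMap` onto the vector
space. Proper surjections are quotient maps, and this makes the bijections above homeomorphisms.

Smoothness: in a chart, the multipole map is `conicMap : (p, ν) ↦ ν p p*`, where `p` is monic with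
all roots in the open unit disc and `p*` is its dual. The roots of `p*` lie outside the closed disc,
so `p` and `p*` are coprime (`isCoprime_monicPoly`). Coprimality makes both `conicMap` and its
differential injective, and the inverse function theorem gives a smooth inverse. Multipole maps of
two frames differ by a linear map `T` (`IsOrthonormalFrame.exists_changeFrame`), since an orthogonal
change of frame preserves the conic. All transition maps are thus of the form `conicMap⁻¹ ∘ T ∘
conicMap`. -/

/-- The polynomial `(-X)ᴺ · conj P(-1 / conj X)`, for `P` of degree at most `N`. -/
def antipodalDual (N : ℕ) (P : ℂ[X]) : ℂ[X] :=
  C ((-1) ^ N) * reflect N ((P.map (starRingEnd ℂ)).comp (-X))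

theorem coeff_comp_neg_X (P : ℂ[X]) (k : ℕ) : (P.comp (-X)).coeff k = (-1) ^ k * P.coeff k := by
  rw [show (-X : ℂ[X]) = C (-1) * X by simp, comp_C_mul_X_coeff, mul_comm]

/-- The normalizing sign `(-1)^N` and the sign `(-1)^(N-k)` from the substitution `-X` combine to
`(-1)^k`. -/
theorem coeff_antipodalDual {N k : ℕ} (hk : k ≤ N) (P : ℂ[X]) :
    (antipodalDual N P).coeff k = (-1) ^ k * conj (P.coeff (N - k)) := by
  rw [antipodalDual, coeff_C_mul, coeff_reflect, revAt_le hk, coeff_comp_neg_X, coeff_map,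
    ← mul_assoc, ← pow_add]
  congr 1
  obtain ⟨m, rfl⟩ := Nat.exists_eq_add_of_le hk
  rw [Nat.add_sub_cancel_left, show k + m + m = k + 2 * m by ring, pow_add, pow_mul]
  simp

theorem natDegree_comp_neg_X_map_le {N : ℕ} {P : ℂ[X]} (hP : P.natDegree ≤ N) :
    ((P.map (starRingEnd ℂ)).comp (-X)).natDegree ≤ N := by
  refine natDegree_comp_le.trans ?_
  simpa using (natDegree_map_le (f := starRingEnd ℂ)).trans hP

theorem natDegree_antipodalDual_le {N : ℕ} {P : ℂ[X]} (hP : P.natDegree ≤ N) :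
    (antipodalDual N P).natDegree ≤ N := by
  refine (natDegree_C_mul_le _ _).trans ?_
  exact (natDegree_reflect_le).trans (by simp [natDegree_comp_neg_X_map_le hP])

theorem antipodalDual_mul {M N : ℕ} {P R : ℂ[X]} (hP : P.natDegree ≤ M) (hR : R.natDegree ≤ N) :
    antipodalDual (M + N) (P * R) = antipodalDual M P * antipodalDual N R := by
  simp only [antipodalDual, Polynomial.map_mul, mul_comp]
  rw [reflect_mul _ _ (natDegree_comp_neg_X_map_le hP) (natDegree_comp_neg_X_map_le hR), pow_add,
    C_mul]
  ring

theorem antipodalDual_add (N : ℕ) (P R : ℂ[X]) :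
    antipodalDual N (P + R) = antipodalDual N P + antipodalDual N R := by
  simp [antipodalDual, reflect_add, mul_add]

theorem antipodalDual_C_mul (N : ℕ) (t : ℂ) (P : ℂ[X]) :
    antipodalDual N (C t * P) = C (conj t) * antipodalDual N P := by
  simp only [antipodalDual, Polynomial.map_mul, mul_comp, map_C, C_comp, reflect_C_mul]
  ring

/-- The antipode is an involution, but its lift to polynomials of degree at most `N` squares to
`(-1)^N`. Only even `N = 2d` carries a real structure; the factor `(-1)^d` in `IsAntipodalReal` is
the one for which `p p*` is real. -/
theorem antipodalDual_antipodalDual {N : ℕ} {P : ℂ[X]} (hP : P.natDegree ≤ N) :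
    antipodalDual N (antipodalDual N P) = C ((-1) ^ N) * P := by
  ext k
  rcases le_or_gt k N with hk | hk
  · rw [coeff_antipodalDual hk, coeff_antipodalDual (Nat.sub_le _ _), Nat.sub_sub_self hk,
      coeff_C_mul]
    simp only [map_mul, map_pow, map_neg, map_one, Complex.conj_conj]
    rw [← mul_assoc, ← pow_add, Nat.add_sub_of_le hk]
  · rw [coeff_eq_zero_of_natDegree_lt, coeff_C_mul, coeff_eq_zero_of_natDegree_lt (hP.trans_lt hk),
      mul_zero]
    exact (natDegree_antipodalDual_le (natDegree_antipodalDual_le hP)).trans_lt hk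

theorem antipodalDual_X_sub_C (w : ℂ) :
    antipodalDual 1 (X - C w) = 1 + C (conj w) * X := by
  ext k
  rcases le_or_gt k 1 with hk | hk
  · rw [coeff_antipodalDual hk]
    interval_cases k <;> simp [coeff_X, coeff_one, coeff_C]
  · rw [coeff_eq_zero_of_natDegree_lt
      ((natDegree_antipodalDual_le (natDegree_X_sub_C_le w)).trans_lt hk), coeff_eq_zero_of_natDegree_lt]
    refine lt_of_le_of_lt ?_ hk
    compute_degree

theorem natDegree_prod_X_sub_C {d : ℕ} (w : Fin d → ℂ) :
    (∏ j, (X - C (w j))).natDegree = d := by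
  rw [natDegree_prod_of_monic _ _ fun j _ => monic_X_sub_C _]
  simp

theorem antipodalDual_prod_X_sub_C {d : ℕ} (w : Fin d → ℂ) :
    antipodalDual d (∏ j, (X - C (w j))) = ∏ j, (1 + C (conj (w j)) * X) := by
  induction d with
  | zero => simp [antipodalDual, reflect_one]
  | succ d ih =>
    rw [Fin.prod_univ_castSucc, antipodalDual_mul (natDegree_prod_X_sub_C _).le
      (natDegree_X_sub_C_le _), ih, antipodalDual_X_sub_C,
      Fin.prod_univ_castSucc (fun j => 1 + C (conj (w j)) * X)]

/-- The polynomials of degree at most `2d` that are real for the antipodal real structure. -/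
def IsAntipodalReal (d : ℕ) (P : ℂ[X]) : Prop :=
  P.natDegree ≤ 2 * d ∧ antipodalDual (2 * d) P = C ((-1) ^ d) * P

namespace IsAntipodalReal

variable {d e : ℕ} {P R : ℂ[X]}

theorem coeff_eq (hP : IsAntipodalReal d P) {k : ℕ} (hk : k ≤ 2 * d) :
    P.coeff k = (-1) ^ (d + k) * conj (P.coeff (2 * d - k)) := by
  have h := congrArg (fun R => R.coeff k) hP.2
  simp only [coeff_antipodalDual hk, coeff_C_mul] at h
  rw [pow_add, mul_assoc, h, ← mul_assoc, ← pow_add, ← two_mul, pow_mul]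
  simp

theorem of_coeff_eq (hd : P.natDegree ≤ 2 * d)
    (h : ∀ k ≤ 2 * d, P.coeff k = (-1) ^ (d + k) * conj (P.coeff (2 * d - k))) :
    IsAntipodalReal d P := by
  refine ⟨hd, ?_⟩
  ext k
  rcases le_or_gt k (2 * d) with hk | hk
  · rw [coeff_antipodalDual hk, coeff_C_mul, h k hk, ← mul_assoc, ← pow_add, ← add_assoc,
      ← two_mul, pow_add _ (2 * d), pow_mul]
    simp
  · rw [coeff_C_mul, coeff_eq_zero_of_natDegree_lt (hd.trans_lt hk),
      coeff_eq_zero_of_natDegree_lt ((natDegree_antipodalDual_le hd).trans_lt hk), mul_zero]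

theorem zero : IsAntipodalReal d 0 := by
  refine of_coeff_eq (by simp) (by simp)

theorem add (hP : IsAntipodalReal d P) (hR : IsAntipodalReal d R) : IsAntipodalReal d (P + R) :=
  ⟨natDegree_add_le_of_degree_le hP.1 hR.1, by rw [antipodalDual_add, hP.2, hR.2, mul_add]⟩

theorem real_mul (t : ℝ) (hP : IsAntipodalReal d P) : IsAntipodalReal d (C (t : ℂ) * P) :=
  ⟨(natDegree_C_mul_le _ _).trans hP.1, by
    rw [antipodalDual_C_mul, hP.2, Complex.conj_ofReal]; ring⟩

theorem mul (hP : IsAntipodalReal d P) (hR : IsAntipodalReal e R) :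
    IsAntipodalReal (d + e) (P * R) := by
  refine ⟨natDegree_mul_le.trans (by linarith [hP.1, hR.1]), ?_⟩
  rw [mul_add, antipodalDual_mul hP.1 hR.1, hP.2, hR.2, pow_add, C_mul]
  ring

theorem one : IsAntipodalReal 0 1 := of_coeff_eq (by simp) (by
  intro k hk
  obtain rfl : k = 0 := by omega
  simp)

theorem prod {f : Fin d → ℂ[X]} (hf : ∀ j, IsAntipodalReal 1 (f j)) :
    IsAntipodalReal d (∏ j, f j) := by
  induction d with
  | zero => simpa using one
  | succ d ih =>
    rw [Fin.prod_univ_castSucc]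
    exact (ih fun j => hf _).mul (hf _)

/-- If the product with a nonzero antipodally real factor is antipodally real, so is the other
factor. -/
theorem of_mul (hP : IsAntipodalReal d P) (h0 : P ≠ 0) (h : IsAntipodalReal (d + e) (P * R))
    (hR : R.natDegree ≤ 2 * e) : IsAntipodalReal e R := by
  refine ⟨hR, ?_⟩
  have h2 := h.2
  rw [mul_add, antipodalDual_mul hP.1 hR, hP.2, pow_add, C_mul] at h2
  have h3 : (C ((-1 : ℂ) ^ d) * P) ≠ 0 := mul_ne_zero (by simp) h0
  apply mul_left_cancel₀ h3
  rw [h2]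
  ring

end IsAntipodalReal

/-- `p · conj r + conj p · r` is antipodally real. -/
theorem isAntipodalReal_mul_antipodalDual {d : ℕ} {p r : ℂ[X]} (hp : p.natDegree ≤ d)
    (hr : r.natDegree ≤ d) :
    IsAntipodalReal d (r * antipodalDual d p + p * antipodalDual d r) := by
  have hp' := natDegree_antipodalDual_le hp
  have hr' := natDegree_antipodalDual_le hr
  refine ⟨natDegree_add_le_of_degree_le (natDegree_mul_le.trans (by linarith))
    (natDegree_mul_le.trans (by linarith)), ?_⟩
  rw [two_mul, antipodalDual_add, antipodalDual_mul hr hp', antipodalDual_mul hp hr',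
    antipodalDual_antipodalDual hp, antipodalDual_antipodalDual hr]
  ring

theorem isAntipodalReal_self_mul_antipodalDual {d : ℕ} {p : ℂ[X]} (hp : p.natDegree ≤ d) :
    IsAntipodalReal d (p * antipodalDual d p) := by
  have hp' := natDegree_antipodalDual_le hp
  refine ⟨natDegree_mul_le.trans (by linarith), ?_⟩
  rw [two_mul, antipodalDual_mul hp hp', antipodalDual_antipodalDual hp]
  ring

/-! ### Coordinates on the antipodally real polynomials -/

/-- The low coefficients and the real middle coefficient of an antipodally real polynomial. -/
def antipodalCoeffs (d : ℕ) : ℂ[X] →ₗ[ℝ] (Fin d → ℂ) × ℝ where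
  toFun P := (fun k => P.coeff k, (P.coeff d).re)
  map_add' P R := by ext <;> simp
  map_smul' t P := by ext <;> simp

theorem antipodalCoeffs_real_mul (d : ℕ) (t : ℝ) (P : ℂ[X]) :
    antipodalCoeffs d (C (t : ℂ) * P) = t • antipodalCoeffs d P := by
  rw [← map_smul]
  congr 1
  ext k
  simp

/-- Reality ties the coefficient of index `k` to the conjugate of that of index `2d - k`, and for `k
= d` the sign is `+`, so the middle coefficient is a real number. Hence `d` complex numbers and one
real number determine everything. -/
theorem IsAntipodalReal.eq_zero {d : ℕ} {P : ℂ[X]} (hP : IsAntipodalReal d P)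
    (h : antipodalCoeffs d P = 0) : P = 0 := by
  have h1 : ∀ k < d, P.coeff k = 0 := fun k hk => congrFun (congrArg Prod.fst h) ⟨k, hk⟩
  ext k
  rw [coeff_zero]
  rcases lt_trichotomy k d with hk | rfl | hk
  · exact h1 k hk
  · have h2 : (P.coeff k).re = 0 := congrArg Prod.snd h
    have h3 := hP.coeff_eq (k := k) (by omega)
    rw [← two_mul, pow_mul, show 2 * k - k = k by omega] at h3
    simp only [even_two, Even.neg_pow, one_pow, one_mul] at h3
    exact Complex.ext h2 (Complex.conj_eq_iff_im.1 h3.symm)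
  · rcases le_or_gt k (2 * d) with hk' | hk'
    · rw [hP.coeff_eq hk', h1 _ (by omega)]
      simp
    · exact coeff_eq_zero_of_natDegree_lt (hP.1.trans_lt hk')

theorem IsAntipodalReal.ext {d : ℕ} {P R : ℂ[X]} (hP : IsAntipodalReal d P)
    (hR : IsAntipodalReal d R) (h : antipodalCoeffs d P = antipodalCoeffs d R) : P = R := by
  have hs : IsAntipodalReal d (P + C ((-1 : ℝ) : ℂ) * R) := hP.add (hR.real_mul (-1))
  have h0 := hs.eq_zero (by rw [map_add, antipodalCoeffs_real_mul, h]; simp)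
  simpa [← sub_eq_add_neg, sub_eq_zero] using h0

theorem exists_isAntipodalReal (d : ℕ) (h : (Fin d → ℂ) × ℝ) :
    ∃ P, IsAntipodalReal d P ∧ antipodalCoeffs d P = h := by
  -- Coefficients above the middle are forced by those below it. The final `0` is never reached for
  -- `k ≤ 2d`.
  let c : ℕ → ℂ := fun k => if hk : k < d then h.1 ⟨k, hk⟩ else if k = d then (h.2 : ℂ) else
    if hk' : 2 * d - k < d then (-1) ^ (d + k) * conj (h.1 ⟨2 * d - k, hk'⟩) else 0
  let P : ℂ[X] := ∑ k ∈ Finset.range (2 * d + 1), monomial k (c k)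
  have hc : ∀ k, k ≤ 2 * d → P.coeff k = c k := fun k hk => by
    simp only [P, finsetSum_coeff, coeff_monomial]
    rw [Finset.sum_ite_eq', if_pos (by simp; omega)]
  have hdeg : P.natDegree ≤ 2 * d := by
    refine natDegree_sum_le_of_forall_le _ _ fun k hk => (natDegree_monomial_le _).trans ?_
    simp at hk
    omega
  refine ⟨P, .of_coeff_eq hdeg fun k hk => ?_, ?_⟩
  · rw [hc k hk, hc _ (Nat.sub_le _ _)]
    rcases lt_trichotomy k d with hkd | rfl | hkd
    · have h1 : ¬ (2 * d - k < d) := by omega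
      have h2 : ¬ (2 * d - k = d) := by omega
      have h3 : 2 * d - (2 * d - k) = k := by omega
      simp only [c, dif_pos hkd, dif_neg h1, if_neg h2, h3]
      simp only [map_mul, map_pow, map_neg, map_one, Complex.conj_conj]
      rw [← mul_assoc, ← pow_add, show d + k + (d + (2 * d - k)) = 2 * (2 * d) by omega, pow_mul]
      simp
    · have h1 : 2 * k - k = k := by omega
      rw [← two_mul, pow_mul, h1]
      simp [c]
    · have h1 : ¬ k < d := by omega
      have h2 : k ≠ d := by omega
      have h3 : 2 * d - k < d := by omega
      simp only [c, dif_neg h1, if_neg h2, dif_pos h3]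
  · refine Prod.ext (funext fun k => ?_) ?_
    · change P.coeff k = _
      rw [hc _ (by omega)]
      simp [c]
    · change (P.coeff d).re = _
      rw [hc _ (by omega)]
      simp [c]

/-! ### Factorization -/

/-- The antipodally real quadratic polynomial with the roots `w` and `-1 / conj w`. -/
def antipodalPair (w : ℂ) : ℂ[X] := (X - C w) * (1 + C (conj w) * X)

theorem one_add_C_mul_X_ne_zero (w : ℂ) : (1 + C w * X : ℂ[X]) ≠ 0 := fun h => by
  simpa using congrArg (fun R => R.coeff 0) h

theorem antipodalPair_ne_zero (w : ℂ) : antipodalPair w ≠ 0 :=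
  mul_ne_zero (X_sub_C_ne_zero w) (one_add_C_mul_X_ne_zero _)

theorem isAntipodalReal_antipodalPair (w : ℂ) : IsAntipodalReal 1 (antipodalPair w) := by
  rw [antipodalPair, ← antipodalDual_X_sub_C]
  exact isAntipodalReal_self_mul_antipodalDual (natDegree_X_sub_C_le w)

theorem antipodalPair_eq (w : ℂ) :
    antipodalPair w = C (conj w) * X ^ 2 + C ((1 - ‖w‖ ^ 2 : ℝ) : ℂ) * X - C w := by
  have h : ((1 - ‖w‖ ^ 2 : ℝ) : ℂ) = 1 - w * conj w := by
    rw [Complex.mul_conj, Complex.normSq_eq_norm_sq]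
    push_cast
    rfl
  rw [antipodalPair, h]
  simp only [map_sub, map_one, map_mul]
  ring

theorem natDegree_antipodalPair {w : ℂ} (hw : w ≠ 0) : (antipodalPair w).natDegree = 2 := by
  rw [antipodalPair_eq]
  have : conj w ≠ 0 := by simpa using hw
  compute_degree!

/-- Dualizing `P = (X - w) R` shows that `P` is, up to sign, `1 + conj w X` times the dual of `R`:
the antipode of a root is a root. The two linear factors are coprime because no point is its own
antipode. For `w = 0` the antipode is `∞` and the pair reduces to `X`. -/
theorem IsAntipodalReal.antipodalPair_dvd {d : ℕ} {P : ℂ[X]} (hP : IsAntipodalReal d P) {w : ℂ}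
    (hw : P.IsRoot w) : antipodalPair w ∣ P := by
  rcases eq_or_ne w 0 with rfl | h0
  · simpa [antipodalPair] using dvd_iff_isRoot.2 hw
  have h1 : (X - C w) ∣ P := dvd_iff_isRoot.2 hw
  have h2 : (1 + C (conj w) * X) ∣ P := by
    obtain ⟨R, hR⟩ := h1
    rcases eq_or_ne P 0 with rfl | hP0
    · exact dvd_zero _
    have hR0 : R ≠ 0 := by rintro rfl; simp at hR; exact hP0 hR
    have hdeg : P.natDegree = 1 + R.natDegree := by
      rw [hR, natDegree_mul (X_sub_C_ne_zero w) hR0, natDegree_X_sub_C]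
    have hle := hP.1
    have h3 : 2 * d = 1 + (2 * d - 1) := by omega
    have h4 := hP.2
    rw [h3] at h4
    nth_rewrite 1 [hR] at h4
    rw [antipodalDual_mul (natDegree_X_sub_C_le w) (by omega), antipodalDual_X_sub_C] at h4
    have h5 : P = C ((-1) ^ d) * (C ((-1) ^ d) * P) := by
      rw [← mul_assoc, ← C_mul, ← pow_add, ← two_mul, pow_mul]
      simp
    rw [h5, ← h4]
    exact (Dvd.intro _ rfl).mul_left _
  refine IsCoprime.mul_dvd ?_ h1 h2
  -- Bézout identity: `(1 + conj w X) - conj w (X - w) = 1 + |w|²`, a nonzero constant.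
  refine ⟨- C (conj w) * C ((1 + conj w * w)⁻¹), C ((1 + conj w * w)⁻¹), ?_⟩
  have h3 : (1 + conj w * w) ≠ 0 := by
    rw [mul_comm, Complex.mul_conj, ← Complex.ofReal_one, ← Complex.ofReal_add]
    exact_mod_cast (by positivity [Complex.normSq_nonneg w] : (0:ℝ) < 1 + Complex.normSq w).ne'
  have h4 : C ((1 + conj w * w)⁻¹) * (1 + C (conj w) * C w) = (1 : ℂ[X]) := by
    rw [← C_mul, ← C_1, ← C_add, ← C_mul, inv_mul_cancel₀ h3]
  linear_combination h4

theorem IsAntipodalReal.exists_eq_prod {d : ℕ} {P : ℂ[X]} (hP : IsAntipodalReal d P) (h0 : P ≠ 0) :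
    ∃ c : ℝ, c ≠ 0 ∧ ∃ w : Fin d → ℂ, P = C (c : ℂ) * ∏ j, antipodalPair (w j) := by
  induction d generalizing P with
  | zero =>
    obtain ⟨a, rfl⟩ := natDegree_eq_zero.1 (Nat.le_zero.1 hP.1)
    have h := hP.coeff_eq (k := 0) le_rfl
    simp only [coeff_C_zero, add_zero, pow_zero, one_mul, mul_zero, Nat.sub_self] at h
    obtain ⟨c, rfl⟩ := Complex.conj_eq_iff_real.1 h.symm
    exact ⟨c, by rintro rfl; simp at h0, Fin.elim0, by simp⟩
  | succ d ih =>
    -- A nonzero `P` cannot be constant here: its constant coefficient is, up to sign, the conjugate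
    -- of the one of index `2(d + 1) > 0`.
    obtain ⟨w, hw⟩ : ∃ w, P.IsRoot w := by
      refine IsAlgClosed.exists_root P fun hdeg => h0 ?_
      have hnd : P.natDegree = 0 := natDegree_eq_of_degree_eq_some hdeg
      ext k
      rw [coeff_zero]
      rcases Nat.eq_zero_or_pos k with rfl | hk
      · rw [hP.coeff_eq (Nat.zero_le _), coeff_eq_zero_of_natDegree_lt (by omega)]
        simp
      · exact coeff_eq_zero_of_natDegree_lt (by omega)
    obtain ⟨R, rfl⟩ := hP.antipodalPair_dvd hw
    have hR0 : R ≠ 0 := right_ne_zero_of_mul h0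
    have hdeg : R.natDegree ≤ 2 * d := by
      -- For `w = 0` the pair has degree one only. The second drop in degree comes from the root at
      -- `∞`: the top coefficient of `P` vanishes together with the constant one.
      rcases eq_or_ne w 0 with rfl | hw0
      · have h1 := hP.coeff_eq (k := 2 * (d + 1)) le_rfl
        have h2 := hP.1
        simp only [antipodalPair, map_zero, sub_zero, zero_mul, add_zero, mul_one] at h1 h2
        rw [natDegree_X_mul hR0] at h2
        rw [Nat.sub_self, coeff_X_mul_zero, map_zero, mul_zero,
          show 2 * (d + 1) = 2 * d + 1 + 1 by ring, coeff_X_mul] at h1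
        by_contra hlt
        have : R.natDegree = 2 * d + 1 := by omega
        rw [← this] at h1
        exact hR0 (leadingCoeff_eq_zero.1 h1)
      · have h2 := hP.1
        rw [natDegree_mul (antipodalPair_ne_zero w) hR0, natDegree_antipodalPair hw0] at h2
        omega
    have hR : IsAntipodalReal d R := (isAntipodalReal_antipodalPair w).of_mul
      (antipodalPair_ne_zero w) (by rwa [add_comm]) hdeg
    obtain ⟨c, hc, z, rfl⟩ := ih hR hR0
    refine ⟨c, hc, Fin.cons w z, ?_⟩
    rw [Fin.prod_univ_succ]
    simp only [Fin.cons_zero, Fin.cons_succ]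
    ring

/-! ### The coordinate change from roots to coefficients -/

/-- The monic polynomial of degree `d` with the lower coefficients `a`. -/
def monicPoly {d : ℕ} (a : Fin d → ℂ) : ℂ[X] := X ^ d + ∑ k : Fin d, monomial k (a k)

section monicPoly

variable {d : ℕ}

theorem degree_sum_monomial_lt (a : Fin d → ℂ) :
    (∑ k : Fin d, monomial (k : ℕ) (a k)).degree < d := by
  refine (degree_sum_le _ _).trans_lt ((Finset.sup_lt_iff (WithBot.bot_lt_coe _)).2 fun k _ => ?_)
  exact (degree_monomial_le _ _).trans_lt (by exact_mod_cast k.2)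

theorem monic_monicPoly (a : Fin d → ℂ) : (monicPoly a).Monic :=
  monic_X_pow_add (degree_sum_monomial_lt a)

theorem natDegree_monicPoly (a : Fin d → ℂ) : (monicPoly a).natDegree = d := by
  have h : (monicPoly a).degree = d := by
    rw [monicPoly, degree_add_eq_left_of_degree_lt, degree_X_pow]
    rw [degree_X_pow]
    exact degree_sum_monomial_lt a
  exact natDegree_eq_of_degree_eq_some h

theorem coeff_sum_monomial (a : Fin d → ℂ) (k : Fin d) :
    (∑ i : Fin d, monomial (i : ℕ) (a i)).coeff k = a k := by
  simp only [finsetSum_coeff, coeff_monomial, Fin.val_inj]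
  simp

theorem coeff_monicPoly (a : Fin d → ℂ) (k : Fin d) : (monicPoly a).coeff k = a k := by
  rw [monicPoly, coeff_add, coeff_sum_monomial, coeff_X_pow, if_neg k.2.ne, zero_add]

theorem monicPoly_coeff {p : ℂ[X]} (hp : p.Monic) (hd : p.natDegree = d) :
    monicPoly (fun k : Fin d => p.coeff k) = p := by
  ext k
  rcases lt_trichotomy k d with hk | rfl | hk
  · exact coeff_monicPoly _ ⟨k, hk⟩
  · have h1 := (monic_monicPoly fun i : Fin k => p.coeff i).coeff_natDegree
    rw [natDegree_monicPoly] at h1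
    rw [h1, ← hd, hp.coeff_natDegree]
  · rw [coeff_eq_zero_of_natDegree_lt (by rwa [natDegree_monicPoly]),
      coeff_eq_zero_of_natDegree_lt (by rwa [hd])]

theorem monicPoly_rootCoeffs (w : Fin d → ℂ) : monicPoly (rootCoeffs w) = ∏ j, (X - C (w j)) :=
  monicPoly_coeff (monic_prod_of_monic _ _ fun _ _ => monic_X_sub_C _) (natDegree_prod_X_sub_C w)

theorem monicPoly_injective : Function.Injective (monicPoly (d := d)) := fun a b h => by
  funext k
  rw [← coeff_monicPoly a k, h, coeff_monicPoly]

theorem exists_rootCoeffs_eq (a : Fin d → ℂ) : ∃ w : Fin d → ℂ, rootCoeffs w = a := by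
  have hs := IsAlgClosed.splits (monicPoly a)
  obtain ⟨l, hl⟩ := Quotient.exists_rep (monicPoly a).roots
  replace hl : (l : Multiset ℂ) = (monicPoly a).roots := hl
  have hcard : l.length = d := by
    rw [← Multiset.coe_card, hl, ← hs.natDegree_eq_card_roots, natDegree_monicPoly]
  have hprod := hs.eq_prod_roots_of_monic (monic_monicPoly a)
  rw [← hl, Multiset.map_coe, Multiset.prod_coe] at hprod
  refine ⟨fun j => l.get (j.cast hcard.symm), monicPoly_injective ?_⟩
  rw [monicPoly_rootCoeffs, hprod, ← List.prod_ofFn]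
  congr 1
  exact List.ext_get (by simp [hcard]) fun n h1 h2 => by simp

theorem monicPoly_add_smul (a b : Fin d → ℂ) (t : ℝ) :
    monicPoly (a + t • b) = monicPoly a + C (t : ℂ) * ∑ k : Fin d, monomial (k : ℕ) (b k) := by
  simp only [monicPoly, Pi.add_apply, Pi.smul_apply, map_add, Finset.sum_add_distrib, add_assoc,
    Finset.mul_sum, C_mul_monomial, Complex.real_smul]

theorem contDiff_coeff_monicPoly (i : ℕ) :
    ContDiff ℝ ∞ fun a : Fin d → ℂ => (monicPoly a).coeff i := by
  simp only [monicPoly, coeff_add, finsetSum_coeff, coeff_monomial]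
  refine contDiff_const.add (ContDiff.sum fun k _ => ?_)
  split_ifs
  · exact contDiff_apply ℝ ℂ k
  · exact contDiff_const

end monicPoly

/-! ### The local model of the multipole map and its smooth inverse -/

/-- The map `(p, ν) ↦ ν p p*` from pairs of a monic polynomial and a real number to antipodally
real polynomials, in coordinates. -/
def conicMap (d : ℕ) (x : (Fin d → ℂ) × ℝ) : (Fin d → ℂ) × ℝ :=
  antipodalCoeffs d (C (x.2 : ℂ) * (monicPoly x.1 * antipodalDual d (monicPoly x.1)))

/-- The lower coefficients of the monic polynomials with all roots in the open unit disc. -/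
def discRootSet (d : ℕ) : Set (Fin d → ℂ) := {a | ∀ z, (monicPoly a).IsRoot z → ‖z‖ < 1}

section conicMap

variable {d : ℕ}

theorem contDiff_conicMap : ContDiff ℝ ∞ (conicMap d) := by
  have hc : ∀ k ≤ d, ContDiff ℝ ∞ fun x : (Fin d → ℂ) × ℝ =>
      (C (x.2 : ℂ) * (monicPoly x.1 * antipodalDual d (monicPoly x.1))).coeff k := by
    intro k hk
    simp only [coeff_C_mul]
    simp only [coeff_mul]
    refine (Complex.ofRealCLM.contDiff.comp contDiff_snd).mul (ContDiff.sum fun ij hij => ?_)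
    have hj : ij.2 ≤ d := by
      have := Finset.HasAntidiagonal.mem_antidiagonal.1 hij
      omega
    simp only [coeff_antipodalDual hj]
    refine ((contDiff_coeff_monicPoly _).comp contDiff_fst).mul (contDiff_const.mul ?_)
    exact Complex.conjCLE.contDiff.comp ((contDiff_coeff_monicPoly _).comp contDiff_fst)
  refine ContDiff.prodMk (contDiff_pi.2 fun k => hc k k.2.le) ?_
  exact Complex.reCLM.contDiff.comp (hc d le_rfl)

theorem conicMap_smul (a : Fin d → ℂ) (s t : ℝ) :
    conicMap d (a, s * t) = s • conicMap d (a, t) := by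
  simp only [conicMap]
  rw [← antipodalCoeffs_real_mul]
  push_cast
  rw [C_mul, mul_assoc]

theorem isAntipodalReal_conicMap (a : Fin d → ℂ) (t : ℝ) :
    IsAntipodalReal d (C (t : ℂ) * (monicPoly a * antipodalDual d (monicPoly a))) :=
  (isAntipodalReal_self_mul_antipodalDual (natDegree_monicPoly a).le).real_mul t

/-- A root `w` of the second monic polynomial contributes to its dual the factor `1 + conj w X`,
whose root, if any, has modulus `1/|w| > 1`, while the roots of `monicPoly a` have modulus less than
one. -/
theorem isCoprime_monicPoly {a b : Fin d → ℂ} (ha : a ∈ discRootSet d) (hb : b ∈ discRootSet d) :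
    IsCoprime (monicPoly a) (antipodalDual d (monicPoly b)) := by
  obtain ⟨w, rfl⟩ := exists_rootCoeffs_eq b
  have hw : ∀ j, ‖w j‖ < 1 := fun j => hb _ (by
    rw [monicPoly_rootCoeffs, IsRoot.def, eval_prod, Finset.prod_eq_zero_iff]
    exact ⟨j, Finset.mem_univ _, by simp⟩)
  rw [isCoprime_iff_aeval_ne_zero_of_isAlgClosed ℂ ℂ]
  intro z
  by_contra! h
  obtain ⟨h1, h2⟩ := h
  rw [coe_aeval_eq_eval] at h1 h2
  have hz := ha z h1
  rw [monicPoly_rootCoeffs, antipodalDual_prod_X_sub_C, eval_prod, Finset.prod_eq_zero_iff] at h2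
  obtain ⟨j, -, hj⟩ := h2
  simp only [eval_add, eval_one, eval_mul, eval_C, eval_X] at hj
  have h3 : ‖conj (w j) * z‖ = 1 := by
    rw [eq_neg_of_add_eq_zero_right hj]; simp
  rw [norm_mul, Complex.norm_conj] at h3
  nlinarith [hw j, norm_nonneg z, norm_nonneg (w j)]

theorem antipodalDual_monicPoly_ne_zero (a : Fin d → ℂ) : antipodalDual d (monicPoly a) ≠ 0 := by
  intro h
  have h1 := congrArg (antipodalDual d) h
  rw [antipodalDual_antipodalDual (natDegree_monicPoly a).le] at h1
  have h2 : antipodalDual d 0 = 0 := by simpa using antipodalDual_C_mul d 0 0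
  rw [h2] at h1
  simp [(monic_monicPoly a).ne_zero] at h1

/-- If `s p p* = t q q*`, coprimality of `p` and `q*` gives `p ∣ q`, and symmetrically `q ∣ p`. Both
are monic, so `p = q`, and then the scalars agree. -/
theorem conicMap_injOn : Set.InjOn (conicMap d) (discRootSet d ×ˢ {0}ᶜ) := by
  rintro ⟨a, s⟩ ⟨ha, hs⟩ ⟨b, t⟩ ⟨hb, ht⟩ h
  have hP := (isAntipodalReal_conicMap a s).ext (isAntipodalReal_conicMap b t) h
  have hs' : IsUnit (C (s : ℂ)) := isUnit_C.2 (isUnit_iff_ne_zero.2 (by exact_mod_cast hs))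
  have ht' : IsUnit (C (t : ℂ)) := isUnit_C.2 (isUnit_iff_ne_zero.2 (by exact_mod_cast ht))
  have h1 : monicPoly a ∣ monicPoly b := by
    refine (isCoprime_monicPoly ha hb).dvd_of_dvd_mul_right ?_
    rw [← ht'.dvd_mul_left, ← hP]
    exact (Dvd.intro _ rfl).mul_left _
  have h2 : monicPoly b ∣ monicPoly a := by
    refine (isCoprime_monicPoly hb ha).dvd_of_dvd_mul_right ?_
    rw [← hs'.dvd_mul_left, hP]
    exact (Dvd.intro _ rfl).mul_left _
  obtain rfl : a = b := monicPoly_injective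
    (eq_of_monic_of_associated (monic_monicPoly a) (monic_monicPoly b)
      (associated_of_dvd_dvd h1 h2))
  have h3 : (s : ℂ) = t := C_injective (mul_right_cancel₀
    (mul_ne_zero (monic_monicPoly a).ne_zero (antipodalDual_monicPoly_ne_zero a)) hP)
  rw [Complex.ofReal_injective h3]

/-- The product rule for `ν p p*`, in which `p` varies by a polynomial `r` of lower degree. Along a
real line the map is a cubic polynomial in the parameter, so the derivative is its linear
coefficient. -/
theorem fderiv_conicMap_apply (x y : (Fin d → ℂ) × ℝ) :
    fderiv ℝ (conicMap d) x y = antipodalCoeffs d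
      (C (y.2 : ℂ) * (monicPoly x.1 * antipodalDual d (monicPoly x.1)) + C (x.2 : ℂ) *
        ((∑ k : Fin d, monomial (k : ℕ) (y.1 k)) * antipodalDual d (monicPoly x.1) +
          monicPoly x.1 * antipodalDual d (∑ k : Fin d, monomial (k : ℕ) (y.1 k)))) := by
  set p := monicPoly x.1 with hp
  set r : ℂ[X] := ∑ k : Fin d, monomial (k : ℕ) (y.1 k) with hr
  have hline : HasDerivAt (fun t : ℝ => x + t • y) y 0 := by
    simpa using ((hasDerivAt_id (0 : ℝ)).smul_const y).const_add x
  have h1 : HasDerivAt (fun t : ℝ => conicMap d (x + t • y)) (fderiv ℝ (conicMap d) x y) 0 := by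
    have hd : HasFDerivAt (conicMap d) (fderiv ℝ (conicMap d) x) (x + (0 : ℝ) • y) := by
      simpa using (contDiff_conicMap.differentiable (by simp) x).hasFDerivAt
    exact hd.comp_hasDerivAt (0 : ℝ) hline
  let q := antipodalDual d p
  let q' := antipodalDual d r
  let P₁ := C (y.2 : ℂ) * (p * q) + C (x.2 : ℂ) * (r * q + p * q')
  let P₂ := C (x.2 : ℂ) * (r * q') + C (y.2 : ℂ) * (r * q + p * q')
  let P₃ := C (y.2 : ℂ) * (r * q')
  have h2 : ∀ t : ℝ, conicMap d (x + t • y) = conicMap d x + (t • antipodalCoeffs d P₁ +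
      (t ^ 2 • antipodalCoeffs d P₂ + t ^ 3 • antipodalCoeffs d P₃)) := by
    intro t
    simp only [conicMap, ← antipodalCoeffs_real_mul, ← map_add]
    congr 1
    rw [Prod.fst_add, Prod.snd_add, Prod.smul_fst, Prod.smul_snd, monicPoly_add_smul,
      antipodalDual_add, antipodalDual_C_mul, Complex.conj_ofReal]
    simp only [P₁, P₂, P₃, q, q', smul_eq_mul, Complex.ofReal_add, Complex.ofReal_mul,
      Complex.ofReal_pow, map_add, map_mul, map_pow, ← hp, ← hr]
    ring
  have h3 : HasDerivAt (fun t : ℝ => conicMap d (x + t • y)) (antipodalCoeffs d P₁) 0 := by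
    simp only [h2]
    have e1 := (hasDerivAt_id (0 : ℝ)).smul_const (antipodalCoeffs d P₁)
    have e2 := (hasDerivAt_pow 2 (0 : ℝ)).smul_const (antipodalCoeffs d P₂)
    have e3 := (hasDerivAt_pow 3 (0 : ℝ)).smul_const (antipodalCoeffs d P₃)
    simpa using (e1.add (e2.add e3)).const_add (conicMap d x)
  exact h1.unique h3

/-- The infinitesimal form of the injectivity argument. A kernel vector satisfies `μ p p* + ν (r p*
+ p r*) = 0`, so `p ∣ r p*` and by coprimality `p ∣ r`. As `deg r < d`, this forces `r = 0`, and
then `μ = 0`. -/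
theorem fderiv_conicMap_injective {x : (Fin d → ℂ) × ℝ} (hx : x ∈ discRootSet d ×ˢ {0}ᶜ) :
    Function.Injective (fderiv ℝ (conicMap d) x) := by
  refine (injective_iff_map_eq_zero _).2 fun y hy => ?_
  rw [fderiv_conicMap_apply] at hy
  set p := monicPoly x.1 with hp
  set r : ℂ[X] := ∑ k : Fin d, monomial (k : ℕ) (y.1 k) with hr
  have hrd : r.degree < d := degree_sum_monomial_lt _
  have hr' : r.natDegree ≤ d := natDegree_le_of_degree_le hrd.le
  have hpd : p.natDegree = d := natDegree_monicPoly _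
  have h0 := ((isAntipodalReal_conicMap x.1 y.2).add
    ((isAntipodalReal_mul_antipodalDual hpd.le hr').real_mul x.2)).eq_zero hy
  have hx2 : IsUnit (C (x.2 : ℂ)) := isUnit_C.2 (isUnit_iff_ne_zero.2 (by exact_mod_cast hx.2))
  have h1 : p ∣ r := by
    refine (isCoprime_monicPoly hx.1 hx.1).dvd_of_dvd_mul_right ?_
    rw [← hx2.dvd_mul_left]
    refine ⟨- (C (y.2 : ℂ) * antipodalDual d p + C (x.2 : ℂ) * antipodalDual d r), ?_⟩
    linear_combination h0
  have h2 : r = 0 := eq_zero_of_dvd_of_degree_lt h1 (by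
    rwa [degree_eq_natDegree (monic_monicPoly _).ne_zero, hpd])
  have h3 : antipodalDual d 0 = 0 := by simpa using antipodalDual_C_mul d 0 0
  rw [h2, h3] at h0
  have h4 : (y.2 : ℂ) = 0 := by
    simpa [hp, (monic_monicPoly x.1).ne_zero, antipodalDual_monicPoly_ne_zero] using h0
  refine Prod.ext (funext fun k => ?_) (by exact_mod_cast h4)
  rw [← coeff_sum_monomial y.1 k, ← hr, h2]
  simp

/-- All roots of `p` lie in the open disc exactly when the reversed polynomial `z^d p(1/z)` has no
zero on the closed disc; at `z = 0` its value is `1` since `p` is monic. Nonvanishing on a compact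
set is an open condition on the coefficients. -/
theorem isOpen_discRootSet : IsOpen (discRootSet d) := by
  let f : (Fin d → ℂ) × ℂ → ℂ := fun x => 1 + ∑ k : Fin d, x.1 k * x.2 ^ (d - k)
  have hf : Continuous f := by fun_prop
  have heq : discRootSet d = {a | ∀ z ∈ Metric.closedBall (0 : ℂ) 1, f (a, z) ≠ 0} := by
    have key : ∀ (a : Fin d → ℂ) (z : ℂ), z ≠ 0 → (f (a, z) = 0 ↔ (monicPoly a).IsRoot z⁻¹) := by
      intro a z hz
      have : f (a, z) = z ^ d * (monicPoly a).eval z⁻¹ := by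
        simp only [f, monicPoly, eval_add, eval_pow, eval_X, eval_finsetSum, eval_monomial,
          mul_add, Finset.mul_sum]
        rw [← mul_pow, mul_inv_cancel₀ hz, one_pow]
        congr 1
        refine Finset.sum_congr rfl fun k _ => ?_
        have : z ^ d = z ^ (d - k) * z ^ (k : ℕ) := by rw [← pow_add, Nat.sub_add_cancel k.2.le]
        rw [this, inv_pow]
        field_simp
      rw [this, IsRoot.def]
      simp [hz]
    ext a
    constructor
    · intro ha z hz h0
      rcases eq_or_ne z 0 with rfl | hz0
      · have : ∀ k : Fin d, d - (k : ℕ) ≠ 0 := fun k => by omega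
        simp [f, this] at h0
      · have := ha _ ((key a z hz0).1 h0)
        rw [norm_inv, inv_lt_one₀ (norm_pos_iff.2 hz0)] at this
        simp at hz
        linarith
    · intro ha z hz
      by_contra! h1
      have hz0 : z ≠ 0 := by rintro rfl; simp at h1; linarith
      refine ha z⁻¹ ?_ ((key a _ (inv_ne_zero hz0)).2 (by rwa [inv_inv]))
      simpa using inv_le_one_of_one_le₀ h1
  rw [heq, isOpen_iff_mem_nhds]
  intro a ha
  refine (isCompact_closedBall (0 : ℂ) 1).eventually_forall_of_forall_eventually fun z hz => ?_
  exact hf.continuousAt.eventually_ne (ha z hz)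

/-- The derivative of `conicMap` as an equivalence. -/
def conicMapDeriv {x : (Fin d → ℂ) × ℝ} (hx : x ∈ discRootSet d ×ˢ {0}ᶜ) :
    ((Fin d → ℂ) × ℝ) ≃L[ℝ] (Fin d → ℂ) × ℝ :=
  (LinearEquiv.ofInjectiveEndo (fderiv ℝ (conicMap d) x : ((Fin d → ℂ) × ℝ) →ₗ[ℝ] _)
    (fderiv_conicMap_injective hx)).toContinuousLinearEquiv

theorem hasFDerivAt_conicMap {x : (Fin d → ℂ) × ℝ} (hx : x ∈ discRootSet d ×ˢ {0}ᶜ) :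
    HasFDerivAt (conicMap d) (conicMapDeriv hx : ((Fin d → ℂ) × ℝ) →L[ℝ] _) x :=
  (contDiff_conicMap.differentiable (by simp) x).hasFDerivAt

theorem isOpen_discRootSet_prod : IsOpen (discRootSet d ×ˢ ({0}ᶜ : Set ℝ)) :=
  isOpen_discRootSet.prod isOpen_compl_singleton

/-- `conicMap` as an open partial homeomorphism. -/
def conicMapHomeo (d : ℕ) : OpenPartialHomeomorph ((Fin d → ℂ) × ℝ) ((Fin d → ℂ) × ℝ) :=
  OpenPartialHomeomorph.ofContinuousOpenRestrict conicMap_injOn.bijOn_image.toPartialEquiv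
    contDiff_conicMap.continuous.continuousOn (by
      rw [isOpenMap_iff_nhds_le]
      rintro ⟨x, hx⟩
      -- The inverse function theorem: an invertible strict derivative carries the neighbourhood
      -- filter of a point onto that of its image.
      have h := (contDiff_conicMap.contDiffAt.hasStrictFDerivAt' (hasFDerivAt_conicMap hx)
        (by simp)).map_nhds_eq_of_equiv
      rw [← map_nhds_subtype_coe_eq_nhds hx (isOpen_discRootSet_prod.mem_nhds hx),
        Filter.map_map] at h
      exact h.ge) isOpen_discRootSet_prod

@[simp] theorem coe_conicMapHomeo : ⇑(conicMapHomeo d) = conicMap d := rfl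

theorem contDiffAt_conicMapHomeo_symm {y : (Fin d → ℂ) × ℝ} (hy : y ∈ (conicMapHomeo d).target) :
    ContDiffAt ℝ ∞ (conicMapHomeo d).symm y :=
  (conicMapHomeo d).contDiffAt_symm hy (hasFDerivAt_conicMap ((conicMapHomeo d).map_target hy))
    contDiff_conicMap.contDiffAt

end conicMap

/-! ### Orthonormal frames -/

/-- The polar form of `Q` is an inner product, for which a unit vector extends to an orthonormal
basis. -/
theorem QuadraticMap.PosDef.exists_orthonormal_basis {E : Type*} [AddCommGroup E] [Module ℝ E]
    [FiniteDimensional ℝ E] {ι : Type*} [Fintype ι] (hι : Module.finrank ℝ E = Fintype.card ι)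
    {Q : QuadraticForm ℝ E} (hQ : Q.PosDef) (i₀ : ι) {x : E} (hx : Q x = 1) :
    ∃ v : ι → E, v i₀ = x ∧ (∀ i, Q (v i) = 1) ∧
      ∀ i j, i ≠ j → QuadraticMap.IsOrtho Q (v i) (v j) := by
  let B := QuadraticMap.associated (R := ℝ) Q
  have hB : ∀ x, B x x = Q x := fun x => QuadraticMap.associated_eq_self_apply ℝ Q x
  let core : InnerProductSpace.Core ℝ E :=
    { inner := fun x y => B x y
      conj_inner_symm := fun x y => QuadraticMap.associated_isSymm ℝ Q y x
      re_inner_nonneg := fun x => by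
        change 0 ≤ B x x
        rw [hB]
        exact hQ.nonneg x
      add_left := fun x y z => by simp
      smul_left := fun x y r => by simp
      definite := fun x h => hQ.anisotropic x (by rw [← hB]; exact h) }
  let _ : NormedAddCommGroup E := core.toNormedAddCommGroup
  let _ : InnerProductSpace ℝ E := InnerProductSpace.ofCore core.toCore
  have hinner : ∀ x y : E, inner ℝ x y = B x y := fun x y => rfl
  have hon : Orthonormal ℝ (({i₀} : Set ι).domRestrict fun _ => x) := by
    refine ⟨fun _ => ?_, fun i j hij => (hij (Subsingleton.elim i j)).elim⟩
    have : ‖x‖ ^ 2 = 1 := by rw [← real_inner_self_eq_norm_sq, hinner, hB, hx]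
    exact (pow_eq_one_iff_of_nonneg (norm_nonneg x) two_ne_zero).1 this
  obtain ⟨b, hb⟩ := hon.exists_orthonormalBasis_extension_of_card_eq hι
  refine ⟨b, hb i₀ rfl, fun i => ?_, fun i j hij => ?_⟩
  · rw [← hB, ← hinner, real_inner_self_eq_norm_sq, b.orthonormal.1 i, one_pow]
  · rw [← QuadraticMap.associated_isOrtho]
    exact b.orthonormal.2 hij

/-- Over the infinite field `ℝ`, some vector avoids the finitely many planes on which the given
forms vanish; normalized, it serves as `v₂`. This puts any finite family of forms in the domain of a
single chart. -/
theorem exists_isOrthonormalFrame {Q : QuadraticForm ℝ (Fin 3 → ℝ)} (hQ : Q.PosDef) {ι : Type*}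
    [Finite ι] (L : ι → LinForm) :
    ∃ v, IsOrthonormalFrame Q v ∧ ∀ i, frameValue v 2 (L i).1 ≠ 0 := by
  obtain ⟨f, hf⟩ := Module.exists_dual_forall_apply_ne_zero (K := ℝ)
    -- The additional nonzero form guarantees `x ≠ 0` even when `ι` is empty.
    (fun i : Option ι => i.elim (Pi.single 0 1 : Fin 3 → ℝ) fun i => (L i).1) (by
      rintro (_ | i)
      · simp
      · exact (L i).2)
  let x : Fin 3 → ℝ := fun k => f fun j => if k = j then 1 else 0
  have hx : ∀ M : Fin 3 → ℝ, f M = M ⬝ᵥ x := fun M => by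
    rw [LinearMap.pi_apply_eq_sum_univ f M]
    rfl
  have hx0 : x ≠ 0 := fun h => hf none (by rw [hx, h]; simp)
  have hpos : 0 < Q x := hQ x hx0
  obtain ⟨v, hv, h1, h2⟩ := hQ.exists_orthonormal_basis (ι := Fin 3) (by simp) 2
    (x := (Real.sqrt (Q x))⁻¹ • x) (by
      rw [QuadraticMap.map_smul, smul_eq_mul, ← mul_inv, Real.mul_self_sqrt hpos.le,
        inv_mul_cancel₀ hpos.ne'])
  refine ⟨v, ⟨h1, h2⟩, fun i => ?_⟩
  rw [frameValue, hv, dotProduct_smul, ← hx]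
  exact smul_ne_zero (inv_ne_zero (Real.sqrt_pos.2 hpos).ne') (hf (some i))

namespace IsOrthonormalFrame

variable {Q : QuadraticForm ℝ (Fin 3 → ℝ)} {v v' : Fin 3 → (Fin 3 → ℝ)}

theorem associated_apply (hv : IsOrthonormalFrame Q v) (i j : Fin 3) :
    QuadraticMap.associated (R := ℝ) Q (v i) (v j) = if i = j then 1 else 0 := by
  split_ifs with h
  · rw [h]
    exact (QuadraticMap.associated_eq_self_apply ℝ Q _).trans (hv.1 j)
  · exact QuadraticMap.associated_isOrtho.2 (hv.2 i j h)

theorem associated_sum (hv : IsOrthonormalFrame Q v) (c : Fin 3 → ℝ) (j : Fin 3) :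
    QuadraticMap.associated (R := ℝ) Q (∑ i, c i • v i) (v j) = c j := by
  rw [map_sum, LinearMap.sum_apply]
  simp [hv.associated_apply]

theorem linearIndependent (hv : IsOrthonormalFrame Q v) : LinearIndependent ℝ v := by
  refine Fintype.linearIndependent_iff.2 fun c hc j => ?_
  rw [← hv.associated_sum c j, hc]
  simp

theorem exists_eq_sum (hv : IsOrthonormalFrame Q v) (x : Fin 3 → ℝ) :
    ∃ c : Fin 3 → ℝ, x = ∑ i, c i • v i := by
  let b := basisOfLinearIndependentOfCardEqFinrank hv.linearIndependent (by simp)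
  exact ⟨b.repr x, by simpa [b] using (b.sum_repr x).symm⟩

theorem eq_zero_of_frameValue (hv : IsOrthonormalFrame Q v) {L : Fin 3 → ℝ}
    (h : ∀ i, frameValue v i L = 0) : L = 0 := by
  obtain ⟨c, hc⟩ := hv.exists_eq_sum L
  rw [← dotProduct_self_eq_zero (v := L)]
  nth_rewrite 2 [hc]
  rw [dotProduct_sum]
  refine Finset.sum_eq_zero fun i _ => ?_
  rw [dotProduct_smul]
  simp [show L ⬝ᵥ v i = 0 from h i]

theorem frameValue_injective (hv : IsOrthonormalFrame Q v) {L M : Fin 3 → ℝ}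
    (h : ∀ i, frameValue v i L = frameValue v i M) : L = M := by
  rw [← sub_eq_zero]
  refine hv.eq_zero_of_frameValue fun i => ?_
  rw [frameValue, sub_dotProduct, sub_eq_zero]
  exact h i

theorem exists_frameValue_eq (hv : IsOrthonormalFrame Q v) (l : Fin 3 → ℝ) :
    ∃ L : Fin 3 → ℝ, ∀ i, frameValue v i L = l i := by
  let f : (Fin 3 → ℝ) →ₗ[ℝ] (Fin 3 → ℝ) :=
    { toFun := fun L i => frameValue v i L
      map_add' := fun L M => by ext i; simp [frameValue]
      map_smul' := fun t L => by ext i; simp [frameValue] }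
  have hf : Function.Injective f := fun L M h => hv.frameValue_injective fun i => congrFun h i
  obtain ⟨L, hL⟩ := LinearMap.injective_iff_surjective.1 hf l
  exact ⟨L, fun i => congrFun hL i⟩

/-- Two orthonormal frames differ by an orthogonal matrix. -/
theorem exists_orthogonal (hv : IsOrthonormalFrame Q v) (hv' : IsOrthonormalFrame Q v') :
    ∃ R : Fin 3 → Fin 3 → ℝ, (∀ i j, ∑ k, R i k * R j k = if i = j then 1 else 0) ∧
      ∀ i L, frameValue v' i L = ∑ k, R i k * frameValue v k L := by
  choose R hR using fun i => hv.exists_eq_sum (v' i)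
  refine ⟨R, fun i j => ?_, fun i L => ?_⟩
  · rw [← hv'.associated_apply i j]
    rw [hR j]
    rw [map_sum]
    refine Finset.sum_congr rfl fun k _ => ?_
    rw [map_smul, smul_eq_mul, hR i, hv.associated_sum, mul_comm]
  · rw [frameValue, hR i, dotProduct_sum]
    simp [frameValue]

end IsOrthonormalFrame

/-! ### Linear forms as quadratic polynomials on the conic -/

/-- The complex number `ℓ₀ + i ℓ₁` for a linear form with values `ℓ` on the frame. -/
def frameComplex (v : Fin 3 → (Fin 3 → ℝ)) (L : Fin 3 → ℝ) : ℂ :=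
  (frameValue v 0 L : ℂ) + Complex.I * (frameValue v 1 L : ℂ)

/-- The restriction `L(α(X))` of a linear form to the parametrized conic. -/
def formPoly (v : Fin 3 → (Fin 3 → ℝ)) (L : Fin 3 → ℝ) : ℂ[X] :=
  C (conj (frameComplex v L)) * X ^ 2 + C ((2 * frameValue v 2 L : ℝ) : ℂ) * X -
    C (frameComplex v L)

section formPoly

variable {v : Fin 3 → (Fin 3 → ℝ)} {Q : QuadraticForm ℝ (Fin 3 → ℝ)}

theorem frameComplex_re (L : Fin 3 → ℝ) : (frameComplex v L).re = frameValue v 0 L := by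
  simp [frameComplex]

theorem frameComplex_im (L : Fin 3 → ℝ) : (frameComplex v L).im = frameValue v 1 L := by
  simp [frameComplex]

theorem formPoly_smul (t : ℝ) (L : Fin 3 → ℝ) :
    formPoly v (t • L) = C (t : ℂ) * formPoly v L := by
  have h : frameComplex v (t • L) = t * frameComplex v L := by
    simp only [frameComplex, frameValue_smul]
    push_cast
    ring
  rw [formPoly, formPoly, h, frameValue_smul]
  simp only [map_mul, Complex.conj_ofReal, Complex.ofReal_mul]
  ring

theorem natDegree_formPoly_le (L : Fin 3 → ℝ) : (formPoly v L).natDegree ≤ 2 := by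
  rw [formPoly]
  compute_degree

theorem coeff_formPoly_zero (L : Fin 3 → ℝ) : (formPoly v L).coeff 0 = - frameComplex v L := by
  simp [formPoly]

theorem coeff_formPoly_one (L : Fin 3 → ℝ) :
    (formPoly v L).coeff 1 = ((2 * frameValue v 2 L : ℝ) : ℂ) := by
  simp [formPoly, coeff_C]

theorem coeff_formPoly_two (L : Fin 3 → ℝ) :
    (formPoly v L).coeff 2 = conj (frameComplex v L) := by
  simp [formPoly]

theorem isAntipodalReal_formPoly (L : Fin 3 → ℝ) : IsAntipodalReal 1 (formPoly v L) := by
  refine .of_coeff_eq (natDegree_formPoly_le L) fun k hk => ?_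
  interval_cases k
  · simp [coeff_formPoly_zero, coeff_formPoly_two]
  · rw [show 2 * 1 - 1 = 1 from rfl, coeff_formPoly_one, Complex.conj_ofReal]
    norm_num
  · rw [coeff_formPoly_two, Nat.sub_self, coeff_formPoly_zero]
    norm_num

theorem IsOrthonormalFrame.formPoly_injective (hv : IsOrthonormalFrame Q v) :
    Function.Injective (formPoly v) := fun L M h => by
  have h0 : frameComplex v L = frameComplex v M := by
    simpa [coeff_formPoly_zero] using congrArg (fun P => P.coeff 0) h
  have h1 : frameValue v 2 L = frameValue v 2 M := by
    have := congrArg (fun P => P.coeff 1) h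
    simp only [coeff_formPoly_one, Complex.ofReal_inj] at this
    linarith
  refine hv.frameValue_injective fun i => ?_
  fin_cases i
  · simpa [frameComplex_re] using congrArg Complex.re h0
  · simpa [frameComplex_im] using congrArg Complex.im h0
  · exact h1

theorem IsOrthonormalFrame.formPoly_ne_zero (hv : IsOrthonormalFrame Q v) (L : LinForm) :
    formPoly v L.1 ≠ 0 := fun h => L.2 (hv.formPoly_injective (by
  rw [h, ← zero_smul ℝ (0 : Fin 3 → ℝ), formPoly_smul]
  simp))

/-- The values of `L` on the frame are read off from the coefficients of the pair. The value on `v₂`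
is recorded because it is nonzero as soon as `|w| < 1`, which is what chart domains require. -/
theorem IsOrthonormalFrame.exists_formPoly_eq (hv : IsOrthonormalFrame Q v) (w : ℂ) :
    ∃ L : LinForm, formPoly v L.1 = antipodalPair w ∧ frameValue v 2 L.1 = (1 - ‖w‖ ^ 2) / 2 := by
  obtain ⟨L, hL⟩ := hv.exists_frameValue_eq ![w.re, w.im, (1 - ‖w‖ ^ 2) / 2]
  have h2 : frameValue v 2 L = (1 - ‖w‖ ^ 2) / 2 := hL 2
  have hz : frameComplex v L = w := by
    apply Complex.ext
    · rw [frameComplex_re]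
      exact hL 0
    · rw [frameComplex_im]
      exact hL 1
  have h : formPoly v L = antipodalPair w := by
    rw [formPoly, antipodalPair_eq, hz, h2, mul_div_cancel₀ _ two_ne_zero]
  refine ⟨⟨L, ?_⟩, h, h2⟩
  rintro rfl
  refine antipodalPair_ne_zero w ?_
  rw [← h, ← zero_smul ℝ (0 : Fin 3 → ℝ), formPoly_smul]
  simp

/-- Comparing coefficients in `L(α(u)) = ν (u - w)(1 + conj w u)` and eliminating `w` leaves the
quadratic equation `ν² - 2 ℓ₂ ν - (ℓ₀² + ℓ₁²) = 0`. Its discriminant explains the square root in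
`conicScale`. -/
theorem conicScale_mul_self {L : Fin 3 → ℝ} (hL : frameValue v 2 L ≠ 0) :
    conicScale v L ^ 2 = frameValue v 0 L ^ 2 + frameValue v 1 L ^ 2 +
      2 * frameValue v 2 L * conicScale v L := by
  have hs : Real.sign (frameValue v 2 L) ^ 2 = 1 := by
    rcases Real.sign_apply_eq_of_ne_zero _ hL with h | h <;> rw [h] <;> norm_num
  have hq := Real.sq_sqrt (show
    0 ≤ frameValue v 0 L ^ 2 + frameValue v 1 L ^ 2 + frameValue v 2 L ^ 2 by positivity)
  rw [conicScale]
  linear_combination hs * Real.sqrt (frameValue v 0 L ^ 2 + frameValue v 1 L ^ 2 +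
    frameValue v 2 L ^ 2) ^ 2 + hq

theorem conicScale_mul_frameValue_pos {L : Fin 3 → ℝ} (hL : frameValue v 2 L ≠ 0) :
    0 < conicScale v L * frameValue v 2 L := by
  have hs : 0 < Real.sign (frameValue v 2 L) * frameValue v 2 L :=
    Real.sign_mul_pos_of_ne_zero _ hL
  rw [conicScale, add_mul, mul_right_comm]
  have : 0 < frameValue v 2 L * frameValue v 2 L := mul_self_pos.2 hL
  positivity

theorem conicScale_ne_zero {L : Fin 3 → ℝ} (hL : frameValue v 2 L ≠ 0) : conicScale v L ≠ 0 :=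
  left_ne_zero_of_mul (conicScale_mul_frameValue_pos hL).ne'

theorem conicScale_mul_one_sub {L : Fin 3 → ℝ} (hL : frameValue v 2 L ≠ 0) :
    conicScale v L * (1 - ‖conicCoord v L‖ ^ 2) = 2 * frameValue v 2 L := by
  have h0 := conicScale_ne_zero hL
  have hn : ‖conicCoord v L‖ ^ 2 =
      (frameValue v 0 L ^ 2 + frameValue v 1 L ^ 2) / conicScale v L ^ 2 := by
    change ‖frameComplex v L / _‖ ^ 2 = _
    rw [norm_div, div_pow, Complex.norm_real, Real.norm_eq_abs, sq_abs,
      ← Complex.normSq_eq_norm_sq, Complex.normSq_apply, frameComplex_re, frameComplex_im]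
    ring
  rw [hn]
  field_simp
  linear_combination conicScale_mul_self hL

/-- The sign in `conicScale` selects the root `ν` of the same sign as `ℓ₂`, so `ν² (1 - |w|²) = 2 ν
ℓ₂` is positive. -/
theorem norm_conicCoord_lt_one {L : Fin 3 → ℝ} (hL : frameValue v 2 L ≠ 0) :
    ‖conicCoord v L‖ < 1 := by
  have h1 := conicScale_mul_one_sub hL
  have h2 := conicScale_mul_frameValue_pos hL
  have h3 : 0 < conicScale v L ^ 2 := by have := conicScale_ne_zero hL; positivity
  have h4 : 0 < conicScale v L ^ 2 * (1 - ‖conicCoord v L‖ ^ 2) := by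
    have : conicScale v L ^ 2 * (1 - ‖conicCoord v L‖ ^ 2) =
      2 * (conicScale v L * frameValue v 2 L) := by linear_combination conicScale v L * h1
    rw [this]
    positivity
  have h5 := pos_of_mul_pos_right h4 h3.le
  nlinarith [norm_nonneg (conicCoord v L)]

theorem formPoly_eq {L : Fin 3 → ℝ} (hL : frameValue v 2 L ≠ 0) :
    formPoly v L = C (conicScale v L : ℂ) * antipodalPair (conicCoord v L) := by
  have h0 : (conicScale v L : ℂ) ≠ 0 := by exact_mod_cast conicScale_ne_zero hL
  have hz : frameComplex v L = conicScale v L * conicCoord v L := by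
    change _ = _ * (frameComplex v L / _)
    field_simp
  rw [formPoly, antipodalPair_eq, hz, ← conicScale_mul_one_sub hL]
  simp only [map_mul, Complex.conj_ofReal, Complex.ofReal_mul]
  ring

end formPoly

/-! ### The multipole map -/

/-- Equal multisets of roots mean that the fibres of `w` and `z` over each value have the same size;
bijections between the fibres glue to a permutation. -/
theorem exists_perm_of_prod_X_sub_C_eq {d : ℕ} {w z : Fin d → ℂ}
    (h : ∏ j, (X - C (w j)) = ∏ j, (X - C (z j))) : ∃ σ : Equiv.Perm (Fin d), z = w ∘ σ := by
  have hm : Multiset.map w Finset.univ.val = Multiset.map z Finset.univ.val := by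
    have h2 := congrArg roots h
    have hr : ∀ f : Fin d → ℂ, (∏ j, (X - C (f j))).roots = Multiset.map f Finset.univ.val :=
      fun f => by
        rw [← roots_multiset_prod_X_sub_C (Multiset.map f Finset.univ.val), Multiset.map_map]
        rfl
    rwa [hr, hr] at h2
  have hcard : ∀ c, Fintype.card {j // z j = c} = Fintype.card {j // w j = c} := by
    intro c
    have h1 := congrArg (Multiset.count c) hm
    rw [Multiset.count_map, Multiset.count_map] at h1
    rw [Fintype.card_subtype, Fintype.card_subtype]
    simpa [Finset.card, eq_comm] using h1.symm
  refine ⟨Equiv.ofFiberEquiv (f := z) (g := w) fun c => Fintype.equivOfCardEq (hcard c), ?_⟩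
  funext j
  exact (Equiv.ofFiberEquiv_map _ j).symm

/-- The product of the forms of a multipole, restricted to the parametrized conic. -/
def multipolePoly (v : Fin 3 → (Fin 3 → ℝ)) {d : ℕ} (L : Fin d → LinForm) : ℂ[X] :=
  ∏ j, formPoly v (L j).1

section multipolePoly

variable {v v' : Fin 3 → (Fin 3 → ℝ)} {Q : QuadraticForm ℝ (Fin 3 → ℝ)} {d : ℕ}

theorem isAntipodalReal_multipolePoly (L : Fin d → LinForm) :
    IsAntipodalReal d (multipolePoly v L) :=
  .prod fun _ => isAntipodalReal_formPoly _

theorem multipolePoly_scale (c : Fin d → ℝˣ) (L : Fin d → LinForm) :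
    multipolePoly v (fun j => LinForm.scale (c j) (L j)) =
      C (((∏ j, c j : ℝˣ) : ℝ) : ℂ) * multipolePoly v L := by
  simp only [multipolePoly, LinForm.scale, formPoly_smul, Finset.prod_mul_distrib]
  rw [Units.coe_prod, Complex.ofReal_prod, map_prod]

theorem multipolePoly_perm (σ : Equiv.Perm (Fin d)) (L : Fin d → LinForm) :
    multipolePoly v (fun j => L (σ j)) = multipolePoly v L :=
  Equiv.prod_comp σ fun j => formPoly v (L j).1

end multipolePoly

theorem MultipoleSpace.exists_rep {d : ℕ} (m : MultipoleSpace d) :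
    ∃ L, m = MultipoleSpace.mk L :=
  (Quotient.exists_rep m).imp fun _ h => h.symm

/-- The map from multipoles to antipodally real polynomials, in coordinates. -/
def multipoleMap (v : Fin 3 → (Fin 3 → ℝ)) (d : ℕ) : MultipoleSpace d → (Fin d → ℂ) × ℝ :=
  Quotient.lift (fun L => antipodalCoeffs d (multipolePoly v L)) (by
    rintro L M ⟨σ, c, hc, h⟩
    obtain rfl : M = fun j => LinForm.scale (c j) (L (σ j)) := funext h
    rw [multipolePoly_scale c (fun j => L (σ j)), hc, multipolePoly_perm]
    simp)

section multipoleMap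

variable {v v' : Fin 3 → (Fin 3 → ℝ)} {Q : QuadraticForm ℝ (Fin 3 → ℝ)} {d : ℕ}

theorem multipoleMap_mk (L : Fin d → LinForm) :
    multipoleMap v d (.mk L) = antipodalCoeffs d (multipolePoly v L) := rfl

theorem multipoleMap_mk_scale (c : Fin d → ℝˣ) (L : Fin d → LinForm) :
    multipoleMap v d (.mk fun j => LinForm.scale (c j) (L j)) =
      ((∏ j, c j : ℝˣ) : ℝ) • multipoleMap v d (.mk L) := by
  rw [multipoleMap_mk, multipolePoly_scale, antipodalCoeffs_real_mul, multipoleMap_mk]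

theorem IsOrthonormalFrame.multipoleMap_ne_zero (hv : IsOrthonormalFrame Q v)
    (m : MultipoleSpace d) : multipoleMap v d m ≠ 0 := by
  obtain ⟨L, rfl⟩ := m.exists_rep
  intro h
  have h0 := (isAntipodalReal_multipolePoly L).eq_zero h
  rw [multipolePoly, Finset.prod_eq_zero_iff] at h0
  obtain ⟨j, -, hj⟩ := h0
  exact hv.formPoly_ne_zero _ hj

/-- Multiplying the factorizations `ν_j (X - w_j)(1 + conj w_j X)` collects the first factors into
`p` and the second into its dual, giving `ν p p*` with `ν = ∏ ν_j`. -/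
theorem multipoleMap_mk_eq_conicMap {L : Fin d → LinForm} (hL : ∀ j, frameValue v 2 (L j).1 ≠ 0) :
    multipoleMap v d (.mk L) = conicMap d (MultipoleSpace.chartCoord v d (.mk L)) := by
  change _ = conicMap d (rootCoeffs fun j => conicCoord v (L j).1, ∏ j, conicScale v (L j).1)
  rw [multipoleMap_mk, conicMap, multipolePoly]
  congr 1
  rw [monicPoly_rootCoeffs, antipodalDual_prod_X_sub_C, ← Finset.prod_mul_distrib,
    Complex.ofReal_prod, map_prod, ← Finset.prod_mul_distrib]
  exact Finset.prod_congr rfl fun j _ => formPoly_eq (hL j)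

theorem rootCoeffs_mem_discRootSet_iff {w : Fin d → ℂ} :
    rootCoeffs w ∈ discRootSet d ↔ ∀ j, ‖w j‖ < 1 := by
  simp only [discRootSet, Set.mem_ofPred_eq, monicPoly_rootCoeffs, IsRoot.def, eval_prod,
    Finset.prod_eq_zero_iff, Finset.mem_univ, true_and, eval_sub, eval_X, eval_C, sub_eq_zero]
  constructor
  · exact fun h j => h _ ⟨j, rfl⟩
  · rintro h z ⟨j, rfl⟩
    exact h j

theorem MultipoleSpace.chartCoord_mem {m : MultipoleSpace d}
    (hm : m ∈ MultipoleSpace.chartDomain v d) :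
    MultipoleSpace.chartCoord v d m ∈ discRootSet d ×ˢ {0}ᶜ := by
  obtain ⟨L, rfl, hL⟩ := hm
  refine ⟨rootCoeffs_mem_discRootSet_iff.2 fun j => norm_conicCoord_lt_one (hL j), ?_⟩
  change ∏ j, conicScale v (L j).1 ≠ 0
  exact Finset.prod_ne_zero_iff.2 fun j _ => conicScale_ne_zero (hL j)

theorem multipoleMap_eq_conicMap {m : MultipoleSpace d}
    (hm : m ∈ MultipoleSpace.chartDomain v d) :
    multipoleMap v d m = conicMap d (MultipoleSpace.chartCoord v d m) := by
  obtain ⟨L, rfl, hL⟩ := hm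
  exact multipoleMap_mk_eq_conicMap hL

theorem IsOrthonormalFrame.chartCoord_injOn (hv : IsOrthonormalFrame Q v) :
    Set.InjOn (MultipoleSpace.chartCoord v d) (MultipoleSpace.chartDomain v d) := by
  rintro _ ⟨L, rfl, hL⟩ _ ⟨M, rfl, hM⟩ h
  have h1 : rootCoeffs (fun j => conicCoord v (L j).1) =
    rootCoeffs (fun j => conicCoord v (M j).1) := congrArg Prod.fst h
  have h2 : ∏ j, conicScale v (L j).1 = ∏ j, conicScale v (M j).1 := congrArg Prod.snd h
  obtain ⟨σ, hσ⟩ := exists_perm_of_prod_X_sub_C_eq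
    (w := fun j => conicCoord v (L j).1) (z := fun j => conicCoord v (M j).1) (by
    rw [← monicPoly_rootCoeffs, h1, monicPoly_rootCoeffs])
  -- Once the points are matched, corresponding forms differ by the ratio of their `ν`. These ratios
  -- have product one because the products of the `ν` agree.
  let c : Fin d → ℝˣ := fun j => Units.mk0 (conicScale v (M j).1 / conicScale v (L (σ j)).1)
    (div_ne_zero (conicScale_ne_zero (hM j)) (conicScale_ne_zero (hL _)))
  refine Quotient.sound ⟨σ, c, ?_, fun j => Subtype.ext (hv.formPoly_injective ?_)⟩
  · apply Units.ext
    rw [Units.coe_prod]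
    simp only [c, Units.val_mk0, Units.val_one, Finset.prod_div_distrib]
    rw [Equiv.prod_comp σ fun j => conicScale v (L j).1, h2, div_self]
    exact Finset.prod_ne_zero_iff.2 fun j _ => conicScale_ne_zero (hM j)
  · have hj : conicCoord v (M j).1 = conicCoord v (L (σ j)).1 := congrFun hσ j
    rw [LinForm.scale, formPoly_smul, formPoly_eq (hM j), formPoly_eq (hL _), hj, ← mul_assoc,
      ← C_mul, ← Complex.ofReal_mul]
    simp only [c, Units.val_mk0]
    rw [div_mul_cancel₀ _ (conicScale_ne_zero (hL _))]

theorem IsOrthonormalFrame.multipoleMap_injOn (hv : IsOrthonormalFrame Q v) :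
    Set.InjOn (multipoleMap v d) (MultipoleSpace.chartDomain v d) := by
  intro m hm n hn h
  refine hv.chartCoord_injOn hm hn (conicMap_injOn (MultipoleSpace.chartCoord_mem hm)
    (MultipoleSpace.chartCoord_mem hn) ?_)
  rw [← multipoleMap_eq_conicMap hm, h, multipoleMap_eq_conicMap hn]

/-! ### Change of frame -/

/-- Every isotropic vector of `ℂ³` lies on the homogeneously parametrized conic. -/
theorem exists_conic_param {x : Fin 3 → ℂ} (hx : x 0 ^ 2 + x 1 ^ 2 + x 2 ^ 2 = 0) :
    ∃ s u : ℂ, x 0 = u ^ 2 - s ^ 2 ∧ x 1 = -Complex.I * (u ^ 2 + s ^ 2) ∧ x 2 = 2 * u * s := by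
  -- The first two coordinates determine `u²` and `s²`. Isotropy then gives `x₂ = ± 2us`, and the
  -- sign is absorbed into `s`.
  obtain ⟨u, hu⟩ := IsAlgClosed.exists_pow_nat_eq ((x 0 + Complex.I * x 1) / 2) two_pos
  obtain ⟨s, hs⟩ := IsAlgClosed.exists_pow_nat_eq ((Complex.I * x 1 - x 0) / 2) two_pos
  have hI := Complex.I_sq
  have h : (x 2) ^ 2 = (2 * u * s) ^ 2 := by
    rw [mul_pow, mul_pow, hu, hs]
    linear_combination hx - hI * x 1 ^ 2
  have h0 : x 0 = u ^ 2 - s ^ 2 := by rw [hu, hs]; ring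
  have h1 : x 1 = -Complex.I * (u ^ 2 + s ^ 2) := by
    rw [hu, hs]
    linear_combination x 1 * hI
  rcases sq_eq_sq_iff_eq_or_eq_neg.1 h with h2 | h2
  · exact ⟨s, u, h0, h1, h2⟩
  · exact ⟨-s, u, by rw [neg_sq, h0], by rw [neg_sq, h1], by rw [h2]; ring⟩

theorem eval_homogenize_formPoly (L : Fin 3 → ℝ) (g : Fin 2 → ℂ) :
    MvPolynomial.eval g ((formPoly v L).homogenize 2) =
      conj (frameComplex v L) * g 0 ^ 2 + ((2 * frameValue v 2 L : ℝ) : ℂ) * g 0 * g 1 -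
        frameComplex v L * g 1 ^ 2 := by
  rw [formPoly, homogenize_sub, homogenize_add, homogenize_C_mul, homogenize_C_mul,
    homogenize_X_pow le_rfl, homogenize_X two_ne_zero, homogenize_C]
  simp
  ring

/-- The point `α(z)` of the frame `v'` is isotropic, and remains so when written in `v`, hence lies
on the conic of `v` at a homogeneous parameter `[u : s]`. Homogenization is needed because `s` may
be zero. The pair `g` depends on `z` only, not on `L`. -/
theorem IsOrthonormalFrame.exists_eval_formPoly (hv : IsOrthonormalFrame Q v)
    (hv' : IsOrthonormalFrame Q v') (z : ℂ) : ∃ g : Fin 2 → ℂ, ∀ L,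
      (formPoly v' L).eval z = MvPolynomial.eval g ((formPoly v L).homogenize 2) := by
  obtain ⟨R, hR, hL⟩ := hv.exists_orthogonal hv'
  let a : Fin 3 → ℂ := ![z ^ 2 - 1, -Complex.I * (z ^ 2 + 1), 2 * z]
  let x : Fin 3 → ℂ := fun k => ∑ i, a i * R i k
  have hI := Complex.I_sq
  have hx : x 0 ^ 2 + x 1 ^ 2 + x 2 ^ 2 = 0 := by
    have hR' : ∀ i j, (R i 0 * R j 0 + R i 1 * R j 1 + R i 2 * R j 2 : ℂ) =
        if i = j then 1 else 0 := fun i j => by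
      have := hR i j
      rw [Fin.sum_univ_three] at this
      split_ifs with h
      · rw [if_pos h] at this
        exact_mod_cast this
      · rw [if_neg h] at this
        exact_mod_cast this
    have h00 := hR' 0 0
    have h11 := hR' 1 1
    have h22 := hR' 2 2
    have h01 := hR' 0 1
    have h02 := hR' 0 2
    have h12 := hR' 1 2
    simp only [if_true, if_neg (show (0 : Fin 3) ≠ 1 by decide),
      if_neg (show (0 : Fin 3) ≠ 2 by decide), if_neg (show (1 : Fin 3) ≠ 2 by decide)] at *
    have ha : a 0 ^ 2 + a 1 ^ 2 + a 2 ^ 2 = 0 := by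
      simp only [a, Matrix.cons_val]
      linear_combination (z ^ 2 + 1) ^ 2 * hI
    simp only [x, Fin.sum_univ_three]
    linear_combination ha + a 0 ^ 2 * h00 + a 1 ^ 2 * h11 + a 2 ^ 2 * h22 +
      2 * a 0 * a 1 * h01 + 2 * a 0 * a 2 * h02 + 2 * a 1 * a 2 * h12
  obtain ⟨s, u, h0, h1, h2⟩ := exists_conic_param hx
  refine ⟨![u, s], fun L => ?_⟩
  have e0 := hL 0 L
  have e1 := hL 1 L
  have e2 := hL 2 L
  rw [Fin.sum_univ_three] at e0 e1 e2
  rw [eval_homogenize_formPoly]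
  simp only [formPoly, frameComplex, eval_sub, eval_add, eval_mul, eval_C, eval_pow, eval_X, e0, e1,
    e2, map_add, map_mul, Complex.conj_ofReal, Complex.conj_I, Matrix.cons_val]
  push_cast
  simp only [x, a, Fin.sum_univ_three, Matrix.cons_val] at h0 h1 h2
  linear_combination frameValue v 0 L * h0 + frameValue v 1 L * h1 + frameValue v 2 L * h2

theorem LinearMap.exists_comp_eq_of_ker_le {K V V₁ V₂ : Type*} [Field K] [AddCommGroup V]
    [Module K V] [AddCommGroup V₁] [Module K V₁] [AddCommGroup V₂] [Module K V₂] (f : V →ₗ[K] V₁)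
    (g : V →ₗ[K] V₂) (h : LinearMap.ker f ≤ LinearMap.ker g) : ∃ T : V₁ →ₗ[K] V₂, T ∘ₗ f = g := by
  obtain ⟨T, hT⟩ := LinearMap.exists_extend
    ((LinearMap.ker f).liftQ g h ∘ₗ f.quotKerEquivRange.symm.toLinearMap)
  refine ⟨T, LinearMap.ext fun x => ?_⟩
  have := LinearMap.congr_fun hT ⟨f x, x, rfl⟩
  simp only [LinearMap.comp_apply, Submodule.subtype_apply, LinearEquiv.coe_coe] at this ⊢
  rw [this, LinearMap.quotKerEquivRange_symm_apply_image f x ⟨x, rfl⟩]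
  simp

/-- The linear map need not be written down: it exists once every real linear relation among
products of forms in the frame `v` also holds in `v'`. Evaluation at `z` in the frame `v'` is a
fixed linear functional of the polynomial in the frame `v`, so relations do carry over. -/
theorem IsOrthonormalFrame.exists_changeFrame (hv : IsOrthonormalFrame Q v)
    (hv' : IsOrthonormalFrame Q v') (d : ℕ) :
    ∃ T : ((Fin d → ℂ) × ℝ) →L[ℝ] (Fin d → ℂ) × ℝ,
      ∀ m, multipoleMap v' d m = T (multipoleMap v d m) := by
  let A := fun v => Finsupp.linearCombination ℝ fun L : Fin d → LinForm => multipolePoly v L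
  have hA : ∀ v c, IsAntipodalReal d (A v c) := by
    intro v c
    rw [Finsupp.linearCombination_apply, Finsupp.sum]
    refine Finset.sum_induction _ (IsAntipodalReal d) (fun _ _ => .add) .zero fun L _ => ?_
    have : c L • multipolePoly v L = C (c L : ℂ) * multipolePoly v L := by ext; simp
    rw [this]
    exact (isAntipodalReal_multipolePoly L).real_mul _
  obtain ⟨T, hT⟩ := LinearMap.exists_comp_eq_of_ker_le (antipodalCoeffs d ∘ₗ A v)
      (antipodalCoeffs d ∘ₗ A v') (by
    intro c hc
    have hc0 : A v c = 0 := (hA v c).eq_zero hc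
    suffices h : A v' c = 0 by rw [LinearMap.mem_ker, LinearMap.comp_apply, h, map_zero]
    refine Polynomial.funext fun z => ?_
    obtain ⟨g, hg⟩ := hv.exists_eval_formPoly hv' z
    have key : ∀ L : Fin d → LinForm, (multipolePoly v' L).eval z =
        -- The degree `2d` is written as a sum so that homogenization splits over the product of the
        -- forms.
        MvPolynomial.eval g ((multipolePoly v L).homogenize (∑ _j : Fin d, 2)) := by
      intro L
      rw [multipolePoly, multipolePoly, homogenize_finsetProd fun _ _ => natDegree_formPoly_le _,
        eval_prod, map_prod]
      exact Finset.prod_congr rfl fun j _ => hg _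
    let ev : ℂ[X] →ₗ[ℝ] ℂ := ((MvPolynomial.aeval g).toLinearMap ∘ₗ
      homogenizeLM (R := ℂ) (∑ _j : Fin d, 2)).restrictScalars ℝ
    have h1 : (A v' c).eval z = ev (A v c) := by
      simp only [A, Finsupp.linearCombination_apply, Finsupp.sum, map_sum, map_smul,
        eval_finsetSum, eval_smul]
      refine Finset.sum_congr rfl fun L _ => ?_
      rw [key]
      rfl
    rw [h1, hc0, map_zero, eval_zero])
  refine ⟨LinearMap.toContinuousLinearMap T, fun m => ?_⟩
  obtain ⟨L, rfl⟩ := m.exists_rep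
  have := LinearMap.congr_fun hT (Finsupp.single L 1)
  simpa [A, multipoleMap_mk] using this.symm

/-! ### Global bijectivity of the multipole map and the images of the chart domains -/

theorem multipoleMap_injective (hQ : Q.PosDef) (hv : IsOrthonormalFrame Q v) :
    Function.Injective (multipoleMap v d) := by
  intro m n h
  obtain ⟨L, rfl⟩ := m.exists_rep
  obtain ⟨M, rfl⟩ := n.exists_rep
  -- Two multipoles always lie in a common chart domain, where injectivity is known; the linear
  -- change of frame transfers the equality there.
  obtain ⟨v', hv', hav⟩ := exists_isOrthonormalFrame hQ (Sum.elim L M)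
  obtain ⟨T, hT⟩ := hv.exists_changeFrame hv' d
  refine hv'.multipoleMap_injOn ⟨L, rfl, fun j => hav (.inl j)⟩ ⟨M, rfl, fun j => hav (.inr j)⟩ ?_
  rw [hT, hT, h]

/-- The tuple of scalars `(t, 1, …, 1)`. -/
def firstScale (d : ℕ) (t : ℝˣ) (j : Fin d) : ℝˣ := if (j : ℕ) = 0 then t else 1

theorem prod_firstScale (hd : 1 ≤ d) (t : ℝˣ) : ∏ j, firstScale d t j = t := by
  rw [Finset.prod_eq_single (⟨0, hd⟩ : Fin d)]
  · simp [firstScale]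
  · intro j _ hj
    exact if_neg fun h => hj (Fin.ext h)
  · simp

/-- Factor the polynomial into antipodal pairs and realize each pair by a real form. The leftover
real constant goes into the first form, which exists because `d ≥ 1`. -/
theorem IsOrthonormalFrame.exists_multipoleMap_eq (hv : IsOrthonormalFrame Q v) (hd : 1 ≤ d)
    {h : (Fin d → ℂ) × ℝ} (h0 : h ≠ 0) : ∃ m, multipoleMap v d m = h := by
  obtain ⟨P, hP, rfl⟩ := exists_isAntipodalReal d h
  obtain ⟨c, hc, w, rfl⟩ := hP.exists_eq_prod fun hP0 => h0 (by rw [hP0, map_zero])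
  choose L hL _ using fun j => hv.exists_formPoly_eq (w j)
  refine ⟨.mk fun j => LinForm.scale (firstScale d (Units.mk0 c hc) j) (L j), ?_⟩
  rw [multipoleMap_mk, multipolePoly_scale, prod_firstScale hd, multipolePoly]
  simp only [hL, Units.val_mk0]

/-- In polynomial space, the chart domain is exactly the image of the open set on which `conicMap`
is invertible. Hence the chart is the multipole map followed by `conicMap⁻¹`, and its domain is
open. -/
theorem IsOrthonormalFrame.mem_chartDomain_iff (hQ : Q.PosDef) (hv : IsOrthonormalFrame Q v)
    (hd : 1 ≤ d) (m : MultipoleSpace d) :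
    m ∈ MultipoleSpace.chartDomain v d ↔ multipoleMap v d m ∈ (conicMapHomeo d).target := by
  constructor
  · intro hm
    rw [multipoleMap_eq_conicMap hm]
    exact (conicMapHomeo d).map_source (MultipoleSpace.chartCoord_mem hm)
  · intro hm
    rw [← (conicMapHomeo d).image_source_eq_target] at hm
    obtain ⟨⟨a, t⟩, ⟨ha, ht⟩, hat⟩ := hm
    obtain ⟨w, rfl⟩ := exists_rootCoeffs_eq a
    have hw := rootCoeffs_mem_discRootSet_iff.1 ha
    choose L hL hL2 using fun j => hv.exists_formPoly_eq (w j)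
    have ht0 : t ≠ 0 := ht
    refine ⟨fun j => LinForm.scale (firstScale d (Units.mk0 t ht0) j) (L j),
      multipoleMap_injective hQ hv ?_, fun j => ?_⟩
    · rw [← hat, multipoleMap_mk, multipolePoly_scale, prod_firstScale hd, multipolePoly]
      simp only [hL, Units.val_mk0, coe_conicMapHomeo, conicMap, monicPoly_rootCoeffs,
        antipodalDual_prod_X_sub_C, antipodalPair, Finset.prod_mul_distrib]
    · change frameValue v 2 ((_ : ℝ) • (L j).1) ≠ 0
      rw [frameValue_smul, hL2]
      have := hw j
      have h1 : 0 < 1 - ‖w j‖ ^ 2 := by nlinarith [norm_nonneg (w j)]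
      exact mul_ne_zero (Units.ne_zero _) (by positivity)

end multipoleMap

/-! ### Topology of the multipole spaces -/

section topology

open Topology

variable {v : Fin 3 → (Fin 3 → ℝ)} {Q : QuadraticForm ℝ (Fin 3 → ℝ)} {d : ℕ}

theorem continuous_coeff_prod {X ι : Type*} [TopologicalSpace X] (s : Finset ι)
    {f : ι → X → ℂ[X]} (hf : ∀ i k, Continuous fun x => (f i x).coeff k) (k : ℕ) :
    Continuous fun x => (∏ i ∈ s, f i x).coeff k := by
  induction s using Finset.cons_induction generalizing k with
  | empty => simpa using continuous_const
  | cons i s hi ih =>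
    simp only [Finset.prod_cons, coeff_mul]
    exact continuous_finsetSum _ fun kl _ => (hf i _).mul (ih _)

theorem continuous_frameValue (i : Fin 3) : Continuous (frameValue v i) := by
  unfold frameValue
  simp only [dotProduct]
  fun_prop

theorem continuous_coeff_formPoly (k : ℕ) :
    Continuous fun L : LinForm => (formPoly v L.1).coeff k := by
  have h (i : Fin 3) : Continuous fun L : LinForm => frameValue v i L.1 :=
    (continuous_frameValue i).comp continuous_subtype_val
  have h0 := h 0
  have h1 := h 1
  have h2 := h 2
  have hz : Continuous fun L : LinForm => frameComplex v L.1 := by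
    unfold frameComplex
    fun_prop
  have hz' : Continuous fun L : LinForm => conj (frameComplex v L.1) :=
    Complex.continuous_conj.comp hz
  simp only [formPoly, coeff_sub, coeff_add, coeff_C_mul, coeff_C]
  refine ((hz'.mul continuous_const).add (Continuous.mul (by fun_prop) continuous_const)).sub ?_
  split_ifs
  · exact hz
  · exact continuous_const

theorem continuous_multipoleMap_mk :
    Continuous fun L : Fin d → LinForm => multipoleMap v d (.mk L) := by
  have h (k : ℕ) : Continuous fun L : Fin d → LinForm => (multipolePoly v L).coeff k :=
    continuous_coeff_prod _ (fun i k => (continuous_coeff_formPoly k).comp (continuous_apply i)) k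
  exact (continuous_pi fun k : Fin d => h k).prodMk (Complex.continuous_re.comp (h d))

theorem isQuotientMap_multipoleSpace_mk : IsQuotientMap (MultipoleSpace.mk (d := d)) :=
  isQuotientMap_quot_mk

theorem continuous_multipoleMap : Continuous (multipoleMap v d) :=
  isQuotientMap_multipoleSpace_mk.continuous_iff.2 continuous_multipoleMap_mk

/-- The linear forms with unit coefficient vector. -/
def unitForm (x : Metric.sphere (0 : Fin 3 → ℝ) 1) : LinForm :=
  ⟨x.1, ne_zero_of_mem_unit_sphere x⟩

theorem continuous_unitForm : Continuous unitForm :=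
  continuous_subtype_val.subtype_mk _

/-- The map sending unit linear forms and a scalar to the scaled product. -/
def coneMap (v : Fin 3 → (Fin 3 → ℝ)) (d : ℕ)
    (p : (Fin d → Metric.sphere (0 : Fin 3 → ℝ) 1) × ℝ) : (Fin d → ℂ) × ℝ :=
  p.2 • multipoleMap v d (.mk fun j => unitForm (p.1 j))

theorem continuous_unitForm_pi :
    Continuous fun x : Fin d → Metric.sphere (0 : Fin 3 → ℝ) 1 => fun j => unitForm (x j) :=
  continuous_pi fun j => continuous_unitForm.comp (continuous_apply j)

theorem continuous_coneMap : Continuous (coneMap v d) :=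
  continuous_snd.smul (continuous_multipoleMap_mk.comp (continuous_unitForm_pi.comp continuous_fst))

/-- By compactness of the sphere, products of unit forms have norm at least some `δ > 0`. A bound
`R` on the image therefore bounds the scalar by `R / δ`. -/
theorem IsOrthonormalFrame.isProperMap_coneMap (hv : IsOrthonormalFrame Q v) :
    IsProperMap (coneMap v d) := by
  refine isProperMap_iff_isCompact_preimage.2 ⟨continuous_coneMap, fun K hK => ?_⟩
  let G : (Fin d → Metric.sphere (0 : Fin 3 → ℝ) 1) → ℝ :=
    fun x => ‖multipoleMap v d (.mk fun j => unitForm (x j))‖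
  have hG : Continuous G := (continuous_multipoleMap_mk.comp continuous_unitForm_pi).norm
  have hpos : ∀ x, 0 < G x := fun x => norm_pos_iff.2 (hv.multipoleMap_ne_zero _)
  obtain ⟨δ, hδ, hle⟩ := isCompact_univ.exists_forall_le' hG.continuousOn fun x _ => hpos x
  obtain ⟨R, hR⟩ := hK.isBounded.exists_norm_le
  refine (isCompact_univ.prod (isCompact_closedBall (0 : ℝ) (R / δ))).of_isClosed_subset
    (hK.isClosed.preimage continuous_coneMap) fun p hp => ⟨trivial, ?_⟩
  have h1 := hR _ hp
  rw [coneMap, norm_smul] at h1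
  rw [mem_closedBall_zero_iff, le_div_iff₀ hδ]
  exact (mul_le_mul_of_nonneg_left (hle p.1 trivial) (norm_nonneg _)).trans h1

theorem exists_unitForm_scale (L : LinForm) : ∃ x t, L = LinForm.scale t (unitForm x) := by
  have h : ‖L.1‖ ≠ 0 := norm_ne_zero_iff.2 L.2
  refine ⟨⟨‖L.1‖⁻¹ • L.1, ?_⟩, Units.mk0 ‖L.1‖ h, Subtype.ext ?_⟩
  · rw [mem_sphere_zero_iff_norm, norm_smul, norm_inv, norm_norm, inv_mul_cancel₀ h]
  · simp [LinForm.scale, unitForm, smul_smul, mul_inv_cancel₀ h]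

theorem IsOrthonormalFrame.coneMap_surjective (hv : IsOrthonormalFrame Q v) (hd : 1 ≤ d) :
    Function.Surjective (coneMap v d) := by
  intro h
  rcases eq_or_ne h 0 with rfl | h0
  · have e : LinForm := ⟨1, one_ne_zero⟩
    obtain ⟨x, -⟩ := exists_unitForm_scale e
    exact ⟨(fun _ => x, 0), by simp [coneMap]⟩
  · obtain ⟨m, rfl⟩ := hv.exists_multipoleMap_eq hd h0
    obtain ⟨L, rfl⟩ := m.exists_rep
    choose x t hx using fun j => exists_unitForm_scale (L j)
    refine ⟨(x, ((∏ j, t j : ℝˣ) : ℝ)), ?_⟩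
    rw [coneMap, ← multipoleMap_mk_scale]
    simp only [← hx]

theorem IsOrthonormalFrame.isQuotientMap_coneMap (hv : IsOrthonormalFrame Q v) (hd : 1 ≤ d) :
    IsQuotientMap (coneMap v d) :=
  hv.isProperMap_coneMap.isClosedMap.isQuotientMap continuous_coneMap (hv.coneMap_surjective hd)

/-- Over the complement of `0`, the quotient map `coneMap` factors through the multipole space by
absorbing the nonzero scalar into the first form. So the multipole map is itself a quotient map onto
the punctured space and, being injective, a homeomorphism onto it. -/
theorem multipoleMap_isOpenEmbedding (hQ : Q.PosDef) (hv : IsOrthonormalFrame Q v) (hd : 1 ≤ d) :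
    IsOpenEmbedding (multipoleMap v d) := by
  let f : MultipoleSpace d → ({0}ᶜ : Set ((Fin d → ℂ) × ℝ)) :=
    fun m => ⟨multipoleMap v d m, hv.multipoleMap_ne_zero m⟩
  have hs : ∀ p : coneMap v d ⁻¹' {0}ᶜ, p.1.2 ≠ 0 := fun p h => p.2 (by simp [coneMap, h])
  let g : coneMap v d ⁻¹' {0}ᶜ → MultipoleSpace d := fun p => .mk fun j =>
    LinForm.scale (firstScale d (Units.mk0 p.1.2 (hs p)) j) (unitForm (p.1.1 j))
  have hg : Continuous g := by
    refine isQuotientMap_multipoleSpace_mk.continuous.comp (continuous_pi fun j => ?_)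
    have h1 : Continuous fun p : coneMap v d ⁻¹' {0}ᶜ =>
        (firstScale d (Units.mk0 p.1.2 (hs p)) j : ℝ) := by
      unfold firstScale
      split_ifs
      · exact continuous_snd.comp continuous_subtype_val
      · exact continuous_const
    have h2 : Continuous fun p : coneMap v d ⁻¹' {0}ᶜ => (unitForm (p.1.1 j)).1 :=
      continuous_subtype_val.comp (continuous_unitForm.comp ((continuous_apply j).comp
        (continuous_fst.comp continuous_subtype_val)))
    exact (h1.smul h2).subtype_mk _
  have hfg : f ∘ g = ({0}ᶜ : Set ((Fin d → ℂ) × ℝ)).restrictPreimage (coneMap v d) := by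
    funext p
    apply Subtype.ext
    change multipoleMap v d (.mk _) = coneMap v d p.1
    rw [multipoleMap_mk_scale, prod_firstScale hd]
    rfl
  have hfc : Continuous f := continuous_multipoleMap.subtype_mk _
  have hf : IsHomeomorph f := isHomeomorph_iff_isQuotientMap_injective.2
    ⟨.of_comp hg hfc (by
      rw [hfg]
      exact (hv.isQuotientMap_coneMap hd).restrictPreimage_isOpen isOpen_compl_singleton),
    fun m n h => multipoleMap_injective hQ hv (congrArg Subtype.val h)⟩
  exact (isOpen_compl_singleton.isOpenEmbedding_subtypeVal).comp hf.isOpenEmbedding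

theorem IsOrthonormalFrame.range_multipoleMap (hv : IsOrthonormalFrame Q v) (hd : 1 ≤ d) :
    Set.range (multipoleMap v d) = {0}ᶜ := by
  ext h
  constructor
  · rintro ⟨m, rfl⟩
    exact hv.multipoleMap_ne_zero m
  · exact fun h0 => hv.exists_multipoleMap_eq hd h0

/-! ### The coned multipole space -/

/-- The map from the coned multipole space to antipodally real polynomials, in coordinates. -/
def conedMap (v : Fin 3 → (Fin 3 → ℝ)) (d : ℕ) : ConedMultipoleSpace d → (Fin d → ℂ) × ℝ :=
  Quotient.lift
    (Quotient.lift (fun p : MultipoleSpace d × ℝ => p.2 • multipoleMap v d p.1) (by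
      rintro ⟨m, s⟩ ⟨n, t⟩ ⟨L, c, hm, hn, hs⟩
      simp only at hm hn hs ⊢
      rw [hm, hn, hs, multipoleMap_mk_scale, smul_smul, mul_comm])) (by
    rintro x y (rfl | ⟨⟨m, rfl⟩, ⟨n, rfl⟩⟩)
    · rfl
    · simp)

/-- The point of the coned multipole space represented by a multipole and a scalar. -/
def conedMk {d : ℕ} (p : MultipoleSpace d × ℝ) : ConedMultipoleSpace d :=
  Quotient.mk (conedSetoid d) (Quotient.mk (multipoleLineSetoid d) p)

theorem isQuotientMap_conedMk : IsQuotientMap (conedMk (d := d)) :=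
  isQuotientMap_quot_mk.comp isQuotientMap_quot_mk

theorem conedMap_conedMk (p : MultipoleSpace d × ℝ) :
    conedMap v d (conedMk p) = p.2 • multipoleMap v d p.1 := rfl

theorem continuous_conedMap : Continuous (conedMap v d) :=
  isQuotientMap_conedMk.continuous_iff.2
    (continuous_snd.smul (continuous_multipoleMap.comp continuous_fst))

theorem conedMk_scale (L : Fin d → LinForm) (c : Fin d → ℝˣ) (s : ℝ) :
    conedMk (.mk L, ((∏ j, c j : ℝˣ) : ℝ) * s) =
      conedMk (.mk (fun j => LinForm.scale (c j) (L j)), s) :=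
  congrArg (Quotient.mk (conedSetoid d)) (Quotient.sound (s := multipoleLineSetoid d)
    ⟨L, c, rfl, rfl, rfl⟩)

/-- A nonzero fibre coordinate can be moved into the forms, which reduces to injectivity of the
multipole map. Points with zero coordinate are exactly those that the cone identifies. -/
theorem conedMap_injective (hQ : Q.PosDef) (hv : IsOrthonormalFrame Q v) (hd : 1 ≤ d) :
    Function.Injective (conedMap v d) := by
  intro x y h
  obtain ⟨⟨m, s⟩, rfl⟩ := isQuotientMap_conedMk.surjective x
  obtain ⟨⟨n, t⟩, rfl⟩ := isQuotientMap_conedMk.surjective y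
  obtain ⟨L, rfl⟩ := m.exists_rep
  obtain ⟨M, rfl⟩ := n.exists_rep
  rw [conedMap_conedMk, conedMap_conedMk] at h
  simp only at h
  rcases eq_or_ne s 0 with rfl | hs
  · obtain rfl : t = 0 := by simpa [hv.multipoleMap_ne_zero] using h.symm
    exact Quotient.sound (Or.inr ⟨⟨_, rfl⟩, ⟨_, rfl⟩⟩)
  · have ht : t ≠ 0 := by
      rintro rfl
      simp [hv.multipoleMap_ne_zero, hs] at h
    have key : ∀ (L : Fin d → LinForm) (s : ℝˣ), conedMk (.mk L, (s : ℝ)) =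
        conedMk (.mk (fun j => LinForm.scale (firstScale d s j) (L j)), 1) := fun L s => by
      rw [← conedMk_scale, prod_firstScale hd, mul_one]
    have h1 := key L (Units.mk0 s hs)
    have h2 := key M (Units.mk0 t ht)
    rw [Units.val_mk0] at h1 h2
    rw [h1, h2]
    congr 2
    refine multipoleMap_injective hQ hv ?_
    rw [multipoleMap_mk_scale, multipoleMap_mk_scale, prod_firstScale hd, prod_firstScale hd]
    exact h

theorem isHomeomorph_conedMap (hQ : Q.PosDef) (hv : IsOrthonormalFrame Q v) (hd : 1 ≤ d) :
    IsHomeomorph (conedMap v d) := by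
  refine isHomeomorph_iff_isQuotientMap_injective.2 ⟨?_, conedMap_injective hQ hv hd⟩
  let g : (Fin d → Metric.sphere (0 : Fin 3 → ℝ) 1) × ℝ → ConedMultipoleSpace d :=
    fun p => conedMk (.mk fun j => unitForm (p.1 j), p.2)
  have hg : Continuous g := isQuotientMap_conedMk.continuous.comp
    ((isQuotientMap_multipoleSpace_mk.continuous.comp
      (continuous_unitForm_pi.comp continuous_fst)).prodMk continuous_snd)
  exact .of_comp hg continuous_conedMap (hv.isQuotientMap_coneMap hd)

end topology

/-! ### Real projective space -/

section projective

open Topology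

/-- The saturation of an open set is a union of its rescalings. Openness matters because finite
products of open quotient maps are again quotient maps. -/
theorem Projectivization.isOpenQuotientMap_mk (V : Type*) [AddCommGroup V] [Module ℝ V]
    [TopologicalSpace V] [ContinuousConstSMul ℝ V] :
    IsOpenQuotientMap fun x : {x : V // x ≠ 0} => Projectivization.mk ℝ x.1 x.2 := by
  have hq : IsQuotientMap fun x : {x : V // x ≠ 0} => Projectivization.mk ℝ x.1 x.2 :=
    isQuotientMap_quot_mk
  refine ⟨hq.surjective, hq.continuous, fun U hU => ?_⟩
  rw [← hq.isOpen_preimage]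
  let f : ℝˣ → {x : V // x ≠ 0} → {x : V // x ≠ 0} :=
    fun t x => ⟨(t : ℝ) • x.1, smul_ne_zero t.ne_zero x.2⟩
  have hf : ∀ t, Continuous (f t) := fun t =>
    (continuous_subtype_val.const_smul (t : ℝ)).subtype_mk _
  have : (fun x : {x : V // x ≠ 0} => Projectivization.mk ℝ x.1 x.2) ⁻¹'
      ((fun x : {x : V // x ≠ 0} => Projectivization.mk ℝ x.1 x.2) '' U) = ⋃ t, f t ⁻¹' U := by
    ext x
    simp only [Set.mem_preimage, Set.mem_image, Set.mem_iUnion]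
    constructor
    · rintro ⟨y, hy, h⟩
      obtain ⟨t, ht⟩ := (Projectivization.mk_eq_mk_iff ℝ _ _ _ _).1 h
      refine ⟨t, ?_⟩
      rwa [show f t x = y from Subtype.ext ht]
    · rintro ⟨t, ht⟩
      exact ⟨_, ht, (Projectivization.mk_eq_mk_iff ℝ _ _ _ _).2 ⟨t, rfl⟩⟩
  rw [this]
  exact isOpen_iUnion fun t => hU.preimage (hf t)

namespace RealProj

variable {n : ℕ}

theorem mk_mem_affineDomain {i : Fin (n + 1)} {x : Fin (n + 1) → ℝ} (hx : x ≠ 0) :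
    Projectivization.mk ℝ x hx ∈ affineDomain i ↔ x i ≠ 0 := by
  obtain ⟨t, ht⟩ := Projectivization.exists_smul_eq_mk_rep ℝ x hx
  change (Projectivization.mk ℝ x hx).rep i ≠ 0 ↔ _
  rw [← ht]
  simp [Units.smul_def]

theorem affineCoord_mk (i : Fin (n + 1)) {x : Fin (n + 1) → ℝ} (hx : x ≠ 0) :
    affineCoord i (Projectivization.mk ℝ x hx) = fun j => x (i.succAbove j) / x i := rfl

/-- The homogeneous coordinates with `i`-th entry `1` of a point in affine coordinates. -/
def homogCoord (i : Fin (n + 1)) (y : Fin n → ℝ) : Fin (n + 1) → ℝ :=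
  Fin.insertNth (α := fun _ => ℝ) i 1 y

theorem homogCoord_same (i : Fin (n + 1)) (y : Fin n → ℝ) : homogCoord i y i = 1 := by
  simp [homogCoord]

theorem homogCoord_succAbove (i : Fin (n + 1)) (y : Fin n → ℝ) (j : Fin n) :
    homogCoord i y (i.succAbove j) = y j := by
  simp [homogCoord]

theorem homogCoord_ne_zero (i : Fin (n + 1)) (y : Fin n → ℝ) : homogCoord i y ≠ 0 := fun h => by
  simpa [h] using homogCoord_same i y

theorem contDiff_homogCoord (i : Fin (n + 1)) : ContDiff ℝ ∞ (homogCoord i) := by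
  refine contDiff_pi.2 fun k => ?_
  rcases Fin.eq_self_or_eq_succAbove i k with rfl | ⟨j, rfl⟩
  · simp only [homogCoord_same]
    exact contDiff_const
  · simp only [homogCoord_succAbove]
    exact contDiff_apply ℝ ℝ j

theorem contDiffAt_div (i : Fin (n + 1)) {x : Fin (n + 1) → ℝ} (hx : x i ≠ 0) :
    ContDiffAt ℝ ∞ (fun (x : Fin (n + 1) → ℝ) (j : Fin n) => x (i.succAbove j) / x i) x :=
  contDiffAt_pi.2 fun j =>
    (contDiff_apply ℝ ℝ (i.succAbove j)).contDiffAt.div (contDiff_apply ℝ ℝ i).contDiffAt hx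

theorem isOpen_affineDomain (i : Fin (n + 1)) : IsOpen (affineDomain i) := by
  rw [← (Projectivization.isOpenQuotientMap_mk _).isQuotientMap.isOpen_preimage]
  have : (fun x : {x : Fin (n + 1) → ℝ // x ≠ 0} => Projectivization.mk ℝ x.1 x.2) ⁻¹'
      affineDomain i = {x | x.1 i ≠ 0} := by
    ext x
    exact mk_mem_affineDomain x.2
  rw [this]
  exact isOpen_compl_singleton.preimage ((continuous_apply i).comp continuous_subtype_val)

/-- The affine chart of `ℝPⁿ` with index `i`. -/
def affineChart (i : Fin (n + 1)) : OpenPartialHomeomorph (RealProj n) (Fin n → ℝ) where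
  toFun := affineCoord i
  invFun y := Projectivization.mk ℝ (homogCoord i y) (homogCoord_ne_zero i y)
  source := affineDomain i
  target := Set.univ
  map_source' _ _ := trivial
  map_target' y _ := (mk_mem_affineDomain _).2 (by simp [homogCoord_same])
  left_inv' p hp := by
    induction p using Projectivization.ind with
    | h x hx =>
      have hi : x i ≠ 0 := (mk_mem_affineDomain hx).1 hp
      refine (Projectivization.mk_eq_mk_iff' ℝ _ _ _ _).2 ⟨(x i)⁻¹, funext fun k => ?_⟩
      rcases Fin.eq_self_or_eq_succAbove i k with rfl | ⟨j, rfl⟩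
      · simp [homogCoord_same, hi]
      · rw [homogCoord_succAbove, affineCoord_mk]
        simp [div_eq_inv_mul]
  right_inv' y _ := by
    rw [affineCoord_mk]
    simp [homogCoord_same, homogCoord_succAbove]
  open_source := isOpen_affineDomain i
  open_target := isOpen_univ
  continuousOn_toFun := by
    rw [(Projectivization.isOpenQuotientMap_mk _).isQuotientMap.continuousOn_isOpen_iff
      (isOpen_affineDomain i)]
    intro x hx
    have hi : x.1 i ≠ 0 := (mk_mem_affineDomain x.2).1 hx
    exact (ContinuousAt.comp (g := fun (x : Fin (n + 1) → ℝ) (j : Fin n) =>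
      x (i.succAbove j) / x i) (contDiffAt_div i hi).continuousAt
      continuous_subtype_val.continuousAt).continuousWithinAt
  continuousOn_invFun :=
    ((Projectivization.isOpenQuotientMap_mk _).continuous.comp
      ((contDiff_homogCoord i).continuous.subtype_mk (homogCoord_ne_zero i))).continuousOn

theorem affineChart_mem_stdAtlas (i : Fin (n + 1)) : affineChart i ∈ stdAtlas n :=
  ⟨i, rfl, fun _ _ => rfl⟩

theorem exists_mem_affineDomain (p : RealProj n) : ∃ i, p ∈ affineDomain i := by
  obtain ⟨i, hi⟩ := Function.ne_iff.1 p.rep_nonzero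
  exact ⟨i, hi⟩

/-- The inverse of a chart in the standard atlas. -/
theorem symm_of_mem_stdAtlas {φ : OpenPartialHomeomorph (RealProj n) (Fin n → ℝ)} {i : Fin (n + 1)}
    (hs : φ.source = affineDomain i) (he : Set.EqOn φ (affineCoord i) φ.source) {y : Fin n → ℝ}
    (hy : y ∈ φ.target) :
    φ.symm y = Projectivization.mk ℝ (homogCoord i y) (homogCoord_ne_zero i y) := by
  have h1 : φ.symm y ∈ affineDomain i := hs ▸ φ.map_target hy
  refine (affineChart i).injOn h1 ((affineChart i).map_target (x := y) trivial) ?_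
  change affineCoord i (φ.symm y) = affineChart i ((affineChart i).symm y)
  rw [(affineChart i).right_inv trivial, ← he (φ.map_target hy), φ.right_inv hy]

/-- `ℝPⁿ` with the standard atlas. -/
@[reducible]
def stdChartedSpace (n : ℕ) : ChartedSpace (Fin n → ℝ) (RealProj n) where
  atlas := stdAtlas n
  chartAt p := affineChart (exists_mem_affineDomain p).choose
  mem_chart_source p := (exists_mem_affineDomain p).choose_spec
  chart_mem_atlas _ := affineChart_mem_stdAtlas _

theorem isManifold_stdChartedSpace (n : ℕ) :
    letI := stdChartedSpace n
    IsManifold 𝓘(ℝ, Fin n → ℝ) ∞ (RealProj n) := by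
  let _ := stdChartedSpace n
  refine isManifold_of_contDiffOn _ _ _ ?_
  -- Atlas members are known only through their source and their values there, so the argument
  -- treats arbitrary members and not just the charts constructed above.
  rintro φ ψ ⟨i, hφ, hφ'⟩ ⟨k, hψ, hψ'⟩
  simp only [modelWithCornersSelf_coe, modelWithCornersSelf_coe_symm, Function.comp_id,
    Function.id_comp, Set.range_id, Set.preimage_id, Set.inter_univ]
  intro y hy
  have hy1 : y ∈ φ.target := hy.1
  have hy2 : φ.symm y ∈ ψ.source := hy.2
  have hk : homogCoord i y k ≠ 0 := by
    rwa [hψ, symm_of_mem_stdAtlas hφ hφ' hy1, mk_mem_affineDomain] at hy2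
  have hcd := (contDiffAt_div k hk).comp y (contDiff_homogCoord i).contDiffAt
  refine hcd.contDiffWithinAt.congr (fun z hz => ?_) ?_
  · have hz2 : φ.symm z ∈ ψ.source := hz.2
    change ψ (φ.symm z) = _
    rw [hψ' hz2, symm_of_mem_stdAtlas hφ hφ' hz.1, affineCoord_mk]
    rfl
  · change ψ (φ.symm y) = _
    rw [hψ' hy2, symm_of_mem_stdAtlas hφ hφ' hy1, affineCoord_mk]
    rfl

end RealProj

end projective

/-! ### The smooth structure of the multipole space -/

section smooth

open Topology

variable {v v' : Fin 3 → (Fin 3 → ℝ)} {Q : QuadraticForm ℝ (Fin 3 → ℝ)} {d : ℕ}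

instance MultipoleSpace.instNonempty : Nonempty (MultipoleSpace d) :=
  ⟨.mk fun _ => ⟨1, one_ne_zero⟩⟩

/-- The multipole map as an open partial homeomorphism. -/
def multipoleHomeo (hQ : Q.PosDef) (hv : IsOrthonormalFrame Q v) (hd : 1 ≤ d) :
    OpenPartialHomeomorph (MultipoleSpace d) ((Fin d → ℂ) × ℝ) :=
  (multipoleMap_isOpenEmbedding hQ hv hd).toOpenPartialHomeomorph (multipoleMap v d)

theorem multipoleHomeo_target (hQ : Q.PosDef) (hv : IsOrthonormalFrame Q v) (hd : 1 ≤ d) :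
    (multipoleHomeo hQ hv hd).target = {0}ᶜ := by
  rw [multipoleHomeo, IsOpenEmbedding.toOpenPartialHomeomorph_target, hv.range_multipoleMap hd]

theorem multipoleMap_multipoleHomeo_symm (hQ : Q.PosDef) (hv : IsOrthonormalFrame Q v)
    (hd : 1 ≤ d) {h : (Fin d → ℂ) × ℝ} (h0 : h ≠ 0) :
    multipoleMap v d ((multipoleHomeo hQ hv hd).symm h) = h :=
  (multipoleHomeo hQ hv hd).right_inv (by rwa [multipoleHomeo_target])

theorem multipoleHomeo_symm_multipoleMap (hQ : Q.PosDef) (hv : IsOrthonormalFrame Q v)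
    (hd : 1 ≤ d) (m : MultipoleSpace d) :
    (multipoleHomeo hQ hv hd).symm (multipoleMap v d m) = m :=
  (multipoleHomeo hQ hv hd).left_inv trivial

theorem continuousAt_multipoleHomeo_symm (hQ : Q.PosDef) (hv : IsOrthonormalFrame Q v)
    (hd : 1 ≤ d) {h : (Fin d → ℂ) × ℝ} (h0 : h ≠ 0) :
    ContinuousAt (multipoleHomeo hQ hv hd).symm h :=
  (multipoleHomeo hQ hv hd).continuousAt_symm (by rwa [multipoleHomeo_target])

/-- The chart of the multipole space given by an orthonormal frame. -/
def multipoleChart (hQ : Q.PosDef) (hv : IsOrthonormalFrame Q v) (hd : 1 ≤ d) :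
    OpenPartialHomeomorph (MultipoleSpace d) ((Fin d → ℂ) × ℝ) :=
  multipoleHomeo hQ hv hd ≫ₕ (conicMapHomeo d).symm

theorem conicMapHomeo_symm_multipoleMap {m : MultipoleSpace d}
    (hm : m ∈ MultipoleSpace.chartDomain v d) :
    (conicMapHomeo d).symm (multipoleMap v d m) = MultipoleSpace.chartCoord v d m := by
  rw [multipoleMap_eq_conicMap hm]
  exact (conicMapHomeo d).left_inv (MultipoleSpace.chartCoord_mem hm)

theorem multipoleChart_source (hQ : Q.PosDef) (hv : IsOrthonormalFrame Q v) (hd : 1 ≤ d) :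
    (multipoleChart hQ hv hd).source = MultipoleSpace.chartDomain v d := by
  ext m
  rw [hv.mem_chartDomain_iff hQ hd, multipoleChart, OpenPartialHomeomorph.trans_source]
  exact ⟨fun h => h.2, fun h => ⟨trivial, h⟩⟩

theorem multipoleChart_mem_conicAtlas (hQ : Q.PosDef) (hv : IsOrthonormalFrame Q v)
    (hd : 1 ≤ d) : multipoleChart hQ hv hd ∈ MultipoleSpace.conicAtlas Q d := by
  refine ⟨v, hv, multipoleChart_source hQ hv hd, fun m hm => ?_⟩
  rw [multipoleChart_source] at hm
  exact conicMapHomeo_symm_multipoleMap hm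

theorem MultipoleSpace.exists_mem_chartDomain (hQ : Q.PosDef) (m : MultipoleSpace d) :
    ∃ v, IsOrthonormalFrame Q v ∧ m ∈ MultipoleSpace.chartDomain v d := by
  obtain ⟨L, rfl⟩ := m.exists_rep
  obtain ⟨v, hv, hL⟩ := exists_isOrthonormalFrame hQ L
  exact ⟨v, hv, L, rfl, hL⟩

/-- The multipole space with the atlas defined by a positive definite form. -/
@[reducible]
def multipoleChartedSpace (hQ : Q.PosDef) (hd : 1 ≤ d) :
    ChartedSpace ((Fin d → ℂ) × ℝ) (MultipoleSpace d) where
  atlas := MultipoleSpace.conicAtlas Q d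
  chartAt m := multipoleChart hQ (m.exists_mem_chartDomain hQ).choose_spec.1 hd
  mem_chart_source m := by
    rw [multipoleChart_source]
    exact (m.exists_mem_chartDomain hQ).choose_spec.2
  chart_mem_atlas m := multipoleChart_mem_conicAtlas hQ _ hd

/-- In a chart of the atlas, the multipole map for the same frame is `conicMap`. -/
theorem multipoleMap_chart_symm
    {e : OpenPartialHomeomorph (MultipoleSpace d) ((Fin d → ℂ) × ℝ)}
    (hs : e.source = MultipoleSpace.chartDomain v d)
    (he : Set.EqOn e (MultipoleSpace.chartCoord v d) e.source) {x : (Fin d → ℂ) × ℝ}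
    (hx : x ∈ e.target) : multipoleMap v d (e.symm x) = conicMap d x := by
  have h1 := e.map_target hx
  rw [multipoleMap_eq_conicMap (hs ▸ h1), ← he h1, e.right_inv hx]

/-- Transition maps are `conicMap⁻¹ ∘ T ∘ conicMap` with `T` the linear change of frame. -/
theorem isManifold_multipoleChartedSpace (hQ : Q.PosDef) (hd : 1 ≤ d) :
    letI := multipoleChartedSpace hQ hd
    IsManifold 𝓘(ℝ, (Fin d → ℂ) × ℝ) ∞ (MultipoleSpace d) := by
  let _ := multipoleChartedSpace hQ hd
  refine isManifold_of_contDiffOn _ _ _ ?_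
  rintro e e' ⟨v, hv, hs, he⟩ ⟨v', hv', hs', he'⟩
  obtain ⟨T, hT⟩ := hv.exists_changeFrame hv' d
  simp only [modelWithCornersSelf_coe, modelWithCornersSelf_coe_symm, Function.comp_id,
    Function.id_comp, Set.range_id, Set.preimage_id, Set.inter_univ]
  have key : ∀ x ∈ (e.symm ≫ₕ e').source, T (conicMap d x) ∈ (conicMapHomeo d).target ∧
      e' (e.symm x) = (conicMapHomeo d).symm (T (conicMap d x)) := by
    intro x hx
    have hx1 : x ∈ e.target := hx.1
    have hx2 : e.symm x ∈ e'.source := hx.2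
    have hx3 : e.symm x ∈ MultipoleSpace.chartDomain v' d := hs' ▸ hx2
    rw [← multipoleMap_chart_symm hs he hx1, ← hT, he' hx2,
      conicMapHomeo_symm_multipoleMap hx3]
    exact ⟨(hv'.mem_chartDomain_iff hQ hd _).1 hx3, rfl⟩
  intro x hx
  have hcd : ContDiffAt ℝ ∞ (fun x => (conicMapHomeo d).symm (T (conicMap d x))) x :=
    ContDiffAt.comp x (contDiffAt_conicMapHomeo_symm (key x hx).1)
      (T.contDiff.comp contDiff_conicMap).contDiffAt
  exact hcd.contDiffWithinAt.congr (fun z hz => (key z hz).2) (key x hx).2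

theorem contMDiff_multipoleMap (hQ : Q.PosDef) (hv : IsOrthonormalFrame Q v) (hd : 1 ≤ d) :
    letI := multipoleChartedSpace hQ hd
    ContMDiff 𝓘(ℝ, (Fin d → ℂ) × ℝ) 𝓘(ℝ, (Fin d → ℂ) × ℝ) ∞ (multipoleMap v d) := by
  let _ := multipoleChartedSpace hQ hd
  intro m
  rw [contMDiffAt_iff]
  refine ⟨continuous_multipoleMap.continuousAt, ?_⟩
  obtain ⟨v', hv', hs, he⟩ := chart_mem_atlas ((Fin d → ℂ) × ℝ) m
  obtain ⟨T, hT⟩ := hv'.exists_changeFrame hv d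
  simp only [mfld_simps]
  have hcd : ContDiffAt ℝ ∞ (fun x => T (conicMap d x)) (chartAt ((Fin d → ℂ) × ℝ) m m) :=
    (T.contDiff.comp contDiff_conicMap).contDiffAt
  refine (hcd.congr_of_eventuallyEq ?_).contDiffWithinAt
  filter_upwards [(chartAt ((Fin d → ℂ) × ℝ) m).open_target.mem_nhds (mem_chart_target _ m)]
    with x hx
  rw [← multipoleMap_chart_symm hs he hx, ← hT]
  rfl

/-- In a chart of a frame `v'`, the inverse multipole map reads `conicMap⁻¹ ∘ T` near `h`. -/
theorem contMDiffAt_multipoleHomeo_symm (hQ : Q.PosDef) (hv : IsOrthonormalFrame Q v)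
    (hd : 1 ≤ d) {h : (Fin d → ℂ) × ℝ} (h0 : h ≠ 0) :
    letI := multipoleChartedSpace hQ hd
    ContMDiffAt 𝓘(ℝ, (Fin d → ℂ) × ℝ) 𝓘(ℝ, (Fin d → ℂ) × ℝ) ∞ (multipoleHomeo hQ hv hd).symm h := by
  let _ := multipoleChartedSpace hQ hd
  rw [contMDiffAt_iff]
  have hc := continuousAt_multipoleHomeo_symm hQ hv hd h0
  refine ⟨hc, ?_⟩
  set m := (multipoleHomeo hQ hv hd).symm h with hm
  obtain ⟨v', hv', hs, he⟩ := chart_mem_atlas ((Fin d → ℂ) × ℝ) m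
  obtain ⟨T, hT⟩ := hv.exists_changeFrame hv' d
  simp only [mfld_simps]
  have hdom : m ∈ MultipoleSpace.chartDomain v' d := hs ▸ mem_chart_source _ m
  have hTh : T h = multipoleMap v' d m := by
    rw [hT, hm, multipoleMap_multipoleHomeo_symm hQ hv hd h0]
  have hcd : ContDiffAt ℝ ∞ (fun x => (conicMapHomeo d).symm (T x)) h := by
    refine ContDiffAt.comp h (contDiffAt_conicMapHomeo_symm ?_) T.contDiff.contDiffAt
    rw [hTh]
    exact (hv'.mem_chartDomain_iff hQ hd _).1 hdom
  refine (hcd.congr_of_eventuallyEq ?_).contDiffWithinAt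
  filter_upwards [isOpen_compl_singleton.mem_nhds h0,
    hc.preimage_mem_nhds ((chartAt ((Fin d → ℂ) × ℝ) m).open_source.mem_nhds
      (mem_chart_source _ m))] with x hx hx'
  have hx2 : (multipoleHomeo hQ hv hd).symm x ∈ MultipoleSpace.chartDomain v' d := hs ▸ hx'
  have h1 := conicMapHomeo_symm_multipoleMap hx2
  rw [hT, multipoleMap_multipoleHomeo_symm hQ hv hd hx] at h1
  rw [h1]
  exact (he hx').trans rfl

/-! ### Diffeomorphisms of the multipole space -/

theorem ContMDiff.of_coe_opens {E F H M : Type*} [NormedAddCommGroup E] [NormedSpace ℝ E]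
    [TopologicalSpace H] {I : ModelWithCorners ℝ E H} [TopologicalSpace M] [ChartedSpace H M]
    [NormedAddCommGroup F] [NormedSpace ℝ F] {U : TopologicalSpace.Opens F} {f : M → U}
    (hf : ContMDiff I 𝓘(ℝ, F) ∞ fun x => (f x : F)) : ContMDiff I 𝓘(ℝ, F) ∞ f := fun x => by
  rw [contMDiffAt_iff_target]
  exact ⟨(continuous_induced_rng.2 hf.continuous).continuousAt, hf x⟩

/-- The target of the multipole map as a Euclidean space. -/
def antipodalEquivEuclidean (d : ℕ) :
    ((Fin d → ℂ) × ℝ) ≃L[ℝ] EuclideanSpace ℝ (Fin (2 * d + 1)) :=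
  ContinuousLinearEquiv.ofFinrankEq (by
    simp [Module.finrank_pi_fintype, Complex.finrank_real_complex, mul_comm])

/-- The multipole space is diffeomorphic to punctured Euclidean space. -/
def multipoleDiffeoPunctured (hQ : Q.PosDef) (hv : IsOrthonormalFrame Q v) (hd : 1 ≤ d) :
    letI := multipoleChartedSpace hQ hd
    MultipoleSpace d
      ≃ₘ^∞⟮𝓘(ℝ, (Fin d → ℂ) × ℝ), 𝓘(ℝ, EuclideanSpace ℝ (Fin (2 * d + 1)))⟯
      puncturedSpace (2 * d + 1) :=
  letI := multipoleChartedSpace hQ hd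
  have hne (y : puncturedSpace (2 * d + 1)) : (antipodalEquivEuclidean d).symm y.1 ≠ 0 := by
    have : y.1 ≠ 0 := y.2
    simpa using this
  { toFun := fun m => ⟨antipodalEquivEuclidean d (multipoleMap v d m), by
      simpa [puncturedSpace] using hv.multipoleMap_ne_zero m⟩
    invFun := fun y => (multipoleHomeo hQ hv hd).symm ((antipodalEquivEuclidean d).symm y)
    left_inv := fun m => by
      simp [multipoleHomeo_symm_multipoleMap]
    right_inv := fun y => Subtype.ext (by
      simp [multipoleMap_multipoleHomeo_symm hQ hv hd (hne y)])
    contMDiff_toFun := ContMDiff.of_coe_opens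
      ((antipodalEquivEuclidean d).contDiff.contMDiff.comp (contMDiff_multipoleMap hQ hv hd))
    contMDiff_invFun := fun y => by
      refine ContMDiffAt.comp (I' := 𝓘(ℝ, (Fin d → ℂ) × ℝ)) (M' := (Fin d → ℂ) × ℝ)
        (f := fun y : puncturedSpace (2 * d + 1) => (antipodalEquivEuclidean d).symm y.1) y
        (contMDiffAt_multipoleHomeo_symm hQ hv hd (hne y)) ?_
      exact ((antipodalEquivEuclidean d).symm.contDiff.contMDiff.comp contMDiff_subtype_val) y }

theorem contMDiff_coe_euclideanSphere (n : ℕ) :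
    ContMDiff (𝓡 n) 𝓘(ℝ, EuclideanSpace ℝ (Fin (n + 1))) ∞
      fun x : Metric.sphere (0 : EuclideanSpace ℝ (Fin (n + 1))) 1 => x.1 :=
  have := Fact.mk (finrank_euclideanSpace_fin (𝕜 := ℝ) (n := n + 1))
  contMDiff_coe_sphere (n := n)

theorem ContMDiff.codRestrict_euclideanSphere {n : ℕ} {E H M : Type*} [NormedAddCommGroup E]
    [NormedSpace ℝ E] [TopologicalSpace H] {I : ModelWithCorners ℝ E H} [TopologicalSpace M]
    [ChartedSpace H M] [IsManifold I ∞ M] {f : M → EuclideanSpace ℝ (Fin (n + 1))}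
    (hf : ContMDiff I 𝓘(ℝ, EuclideanSpace ℝ (Fin (n + 1))) ∞ f)
    (hf' : ∀ x, f x ∈ Metric.sphere (0 : EuclideanSpace ℝ (Fin (n + 1))) 1) :
    ContMDiff I (𝓡 n) ∞
      fun x => (⟨f x, hf' x⟩ : Metric.sphere (0 : EuclideanSpace ℝ (Fin (n + 1))) 1) :=
  have := Fact.mk (finrank_euclideanSpace_fin (𝕜 := ℝ) (n := n + 1))
  ContMDiff.codRestrict_sphere (n := n) (hf' := hf') hf

/-- The multipole space is diffeomorphic to the product of a sphere and a line. -/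
def multipoleDiffeoSphere (hQ : Q.PosDef) (hv : IsOrthonormalFrame Q v) (hd : 1 ≤ d) :
    letI := multipoleChartedSpace hQ hd
    MultipoleSpace d ≃ₘ^∞⟮𝓘(ℝ, (Fin d → ℂ) × ℝ), (𝓡 (2 * d)).prod 𝓘(ℝ, ℝ)⟯
      (Metric.sphere (0 : EuclideanSpace ℝ (Fin (2 * d + 1))) 1 × ℝ) :=
  letI := multipoleChartedSpace hQ hd
  haveI := isManifold_multipoleChartedSpace hQ hd
  let F : MultipoleSpace d → EuclideanSpace ℝ (Fin (2 * d + 1)) :=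
    fun m => antipodalEquivEuclidean d (multipoleMap v d m)
  have hF0 (m : MultipoleSpace d) : F m ≠ 0 := by simpa [F] using hv.multipoleMap_ne_zero m
  have hF : ContMDiff 𝓘(ℝ, (Fin d → ℂ) × ℝ) 𝓘(ℝ, EuclideanSpace ℝ (Fin (2 * d + 1))) ∞ F :=
    (antipodalEquivEuclidean d).contDiff.contMDiff.comp (contMDiff_multipoleMap hQ hv hd)
  have hnorm : ContMDiff 𝓘(ℝ, (Fin d → ℂ) × ℝ) 𝓘(ℝ, ℝ) ∞ fun m => ‖F m‖ := fun m =>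
    ContMDiffAt.comp (I' := 𝓘(ℝ, EuclideanSpace ℝ (Fin (2 * d + 1)))) m
      (contDiffAt_norm ℝ (hF0 m)).contMDiffAt (hF m)
  have hunit (m : MultipoleSpace d) :
      ‖F m‖⁻¹ • F m ∈ Metric.sphere (0 : EuclideanSpace ℝ (Fin (2 * d + 1))) 1 := by
    rw [mem_sphere_zero_iff_norm, norm_smul, norm_inv, norm_norm,
      inv_mul_cancel₀ (norm_ne_zero_iff.2 (hF0 m))]
  have hne (p : Metric.sphere (0 : EuclideanSpace ℝ (Fin (2 * d + 1))) 1 × ℝ) :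
      (antipodalEquivEuclidean d).symm (Real.exp p.2 • p.1.1) ≠ 0 := by
    simpa using ne_zero_of_mem_unit_sphere p.1
  -- Polar coordinates, with the logarithm turning the positive radius into an arbitrary real
  -- number.
  { toFun := fun m => (⟨‖F m‖⁻¹ • F m, hunit m⟩, Real.log ‖F m‖)
    invFun := fun p =>
      (multipoleHomeo hQ hv hd).symm ((antipodalEquivEuclidean d).symm (Real.exp p.2 • p.1.1))
    left_inv := fun m => by
      have h := norm_pos_iff.2 (hF0 m)
      simp only [Real.exp_log h, smul_smul, mul_inv_cancel₀ h.ne', one_smul, F,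
        ContinuousLinearEquiv.symm_apply_apply]
      exact multipoleHomeo_symm_multipoleMap hQ hv hd m
    right_inv := fun p => by
      have h : F ((multipoleHomeo hQ hv hd).symm
          ((antipodalEquivEuclidean d).symm (Real.exp p.2 • p.1.1))) = Real.exp p.2 • p.1.1 := by
        simp only [F]
        rw [multipoleMap_multipoleHomeo_symm hQ hv hd (hne p),
          ContinuousLinearEquiv.apply_symm_apply]
      have hp : ‖p.1.1‖ = 1 := mem_sphere_zero_iff_norm.1 p.1.2
      refine Prod.ext (Subtype.ext ?_) ?_
      · simp only [h, norm_smul, hp, smul_smul, Real.norm_eq_abs, Real.abs_exp, mul_one,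
          inv_mul_cancel₀ (Real.exp_ne_zero _), one_smul]
      · simp only [h, norm_smul, hp, Real.norm_eq_abs, Real.abs_exp, mul_one, Real.log_exp]
    contMDiff_toFun := by
      refine ContMDiff.prodMk ?_ fun m => ?_
      · refine ContMDiff.codRestrict_euclideanSphere ?_ hunit
        exact ContMDiff.smul (fun m => ContMDiffAt.comp (I' := 𝓘(ℝ, ℝ)) (g := fun x => x⁻¹) m
          (contDiffAt_inv ℝ (norm_ne_zero_iff.2 (hF0 m))).contMDiffAt (hnorm m)) hF
      · exact ContMDiffAt.comp (I' := 𝓘(ℝ, ℝ)) m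
          (Real.contDiffAt_log.2 (norm_ne_zero_iff.2 (hF0 m))).contMDiffAt (hnorm m)
    contMDiff_invFun := fun p => by
      refine ContMDiffAt.comp (I' := 𝓘(ℝ, (Fin d → ℂ) × ℝ)) (M' := (Fin d → ℂ) × ℝ)
        (f := fun p : Metric.sphere (0 : EuclideanSpace ℝ (Fin (2 * d + 1))) 1 × ℝ =>
          (antipodalEquivEuclidean d).symm (Real.exp p.2 • p.1.1)) p
        (contMDiffAt_multipoleHomeo_symm hQ hv hd (hne p)) ?_
      have h1 : ContMDiff ((𝓡 (2 * d)).prod 𝓘(ℝ, ℝ)) 𝓘(ℝ, ℝ) ∞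
          fun p : Metric.sphere (0 : EuclideanSpace ℝ (Fin (2 * d + 1))) 1 × ℝ => Real.exp p.2 :=
        Real.contDiff_exp.contMDiff.comp contMDiff_snd
      have h2 : ContMDiff ((𝓡 (2 * d)).prod 𝓘(ℝ, ℝ)) 𝓘(ℝ, EuclideanSpace ℝ (Fin (2 * d + 1))) ∞
          fun p : Metric.sphere (0 : EuclideanSpace ℝ (Fin (2 * d + 1))) 1 × ℝ => p.1.1 :=
        (contMDiff_coe_euclideanSphere (2 * d)).comp contMDiff_fst
      exact ((antipodalEquivEuclidean d).symm.contDiff.contMDiff.comp (h1.smul h2)) p }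

end smooth

/-! ### The symmetric power of the projective plane -/

section symPower

open Topology

variable {v v' : Fin 3 → (Fin 3 → ℝ)} {Q : QuadraticForm ℝ (Fin 3 → ℝ)} {d : ℕ}

/-- The point of `ℝP²` given by a linear form. -/
def projForm (L : LinForm) : RealProj 2 := Projectivization.mk ℝ L.1 L.2

theorem projForm_scale (t : ℝˣ) (L : LinForm) : projForm (LinForm.scale t L) = projForm L :=
  (Projectivization.mk_eq_mk_iff ℝ _ _ _ _).2 ⟨t, rfl⟩

theorem exists_scale_of_projForm_eq {L M : LinForm} (h : projForm L = projForm M) :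
    ∃ t, L = LinForm.scale t M := by
  obtain ⟨t, ht⟩ := (Projectivization.mk_eq_mk_iff ℝ _ _ _ _).1 h
  exact ⟨t, Subtype.ext ht.symm⟩

/-- The quotient map from the multipole space to the symmetric power of `ℝP²`. -/
def toSymPower (d : ℕ) : MultipoleSpace d → SymPower (RealProj 2) d :=
  Quotient.lift (fun L => Quotient.mk (symPowerSetoid _ d) fun j => projForm (L j)) (by
    rintro L M ⟨σ, c, -, h⟩
    refine Quotient.sound ⟨σ, funext fun j => ?_⟩
    rw [h, projForm_scale]
    rfl)

theorem toSymPower_mk (L : Fin d → LinForm) :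
    toSymPower d (.mk L) = Quotient.mk (symPowerSetoid _ d) fun j => projForm (L j) := rfl

/-- The map from tuples of forms is a product of open quotient maps followed by the quotient by
permutations, and it factors through the multipole space. -/
theorem isQuotientMap_toSymPower : IsQuotientMap (toSymPower d) := by
  have h1 : IsQuotientMap fun L : Fin d → LinForm => toSymPower d (.mk L) :=
    (isQuotientMap_quot_mk (r := (symPowerSetoid (RealProj 2) d).r)).comp
      (IsOpenQuotientMap.piMap fun _ : Fin d =>
        Projectivization.isOpenQuotientMap_mk (Fin 3 → ℝ)).isQuotientMap
  exact IsQuotientMap.of_comp_isQuotientMap isQuotientMap_multipoleSpace_mk h1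

/-- The fibres are the `ℝˣ`-orbits, expressed through the equivariant and injective multipole map.
-/
theorem toSymPower_eq_iff (hQ : Q.PosDef) (hv : IsOrthonormalFrame Q v) (hd : 1 ≤ d)
    {m n : MultipoleSpace d} : toSymPower d m = toSymPower d n ↔
      ∃ t : ℝˣ, multipoleMap v d m = (t : ℝ) • multipoleMap v d n := by
  obtain ⟨L, rfl⟩ := m.exists_rep
  obtain ⟨M, rfl⟩ := n.exists_rep
  constructor
  · intro h
    obtain ⟨σ, hσ⟩ : (symPowerSetoid (RealProj 2) d).r _ _ := Quotient.exact h
    choose t ht using fun j => exists_scale_of_projForm_eq (congrFun hσ j)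
    refine ⟨(∏ j, t j)⁻¹, ?_⟩
    have h1 : multipoleMap v d (.mk M) = ((∏ j, t j : ℝˣ) : ℝ) • multipoleMap v d (.mk L) := by
      have hM : M = fun j => LinForm.scale (t j) (L (σ j)) := funext ht
      have hσL : multipoleMap v d (.mk fun j => L (σ j)) = multipoleMap v d (.mk L) := by
        rw [multipoleMap_mk, multipoleMap_mk, multipolePoly_perm]
      rw [← hσL, ← multipoleMap_mk_scale t fun j => L (σ j), ← hM]
    rw [h1, smul_smul, ← Units.val_mul, inv_mul_cancel, Units.val_one, one_smul]
  · rintro ⟨t, ht⟩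
    rw [← prod_firstScale hd t, ← multipoleMap_mk_scale] at ht
    rw [multipoleMap_injective hQ hv ht, toSymPower_mk, toSymPower_mk]
    simp only [projForm_scale]
    rfl

theorem frameValue_rep_projForm (L : LinForm) :
    frameValue v 2 (projForm L).rep ≠ 0 ↔ frameValue v 2 L.1 ≠ 0 := by
  obtain ⟨t, ht⟩ := Projectivization.exists_smul_eq_mk_rep ℝ L.1 L.2
  rw [projForm, ← ht, Units.smul_def, frameValue_smul]
  simp

theorem toSymPower_mem_chartDomain {m : MultipoleSpace d} :
    toSymPower d m ∈ SymPower.chartDomain v d ↔ m ∈ MultipoleSpace.chartDomain v d := by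
  constructor
  · rintro ⟨p, hp, hp2⟩
    obtain ⟨L, rfl⟩ := m.exists_rep
    obtain ⟨σ, hσ⟩ : (symPowerSetoid (RealProj 2) d).r _ _ := Quotient.exact hp
    refine ⟨L, rfl, fun j => ?_⟩
    rw [← frameValue_rep_projForm]
    have := hp2 (σ⁻¹ j)
    rw [hσ] at this
    simpa using this
  · rintro ⟨L, rfl, hL⟩
    exact ⟨_, rfl, fun j => (frameValue_rep_projForm _).2 (hL j)⟩

theorem chartCoord_toSymPower (m : MultipoleSpace d) :
    SymPower.chartCoord v d (toSymPower d m) = (MultipoleSpace.chartCoord v d m).1 := by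
  obtain ⟨L, rfl⟩ := m.exists_rep
  rfl

theorem toSymPower_preimage_chartDomain :
    toSymPower d ⁻¹' SymPower.chartDomain v d = MultipoleSpace.chartDomain v d :=
  Set.ext fun _ => toSymPower_mem_chartDomain

theorem isOpen_symPower_chartDomain (hQ : Q.PosDef) (hv : IsOrthonormalFrame Q v) (hd : 1 ≤ d) :
    IsOpen (SymPower.chartDomain v d) := by
  rw [← isQuotientMap_toSymPower.isOpen_preimage, toSymPower_preimage_chartDomain,
    ← multipoleChart_source hQ hv hd]
  exact (multipoleChart hQ hv hd).open_source

theorem multipoleChart_target (hQ : Q.PosDef) (hv : IsOrthonormalFrame Q v) (hd : 1 ≤ d) :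
    (multipoleChart hQ hv hd).target = discRootSet d ×ˢ {0}ᶜ := by
  ext x
  rw [multipoleChart, OpenPartialHomeomorph.trans_target, multipoleHomeo_target]
  refine ⟨fun h => h.1, fun h => ⟨h, ?_⟩⟩
  change conicMap d x ≠ 0
  intro h0
  have h1 := (isAntipodalReal_conicMap x.1 x.2).eq_zero h0
  have h2 : (x.2 : ℂ) ≠ 0 := by exact_mod_cast h.2
  simp [(monic_monicPoly x.1).ne_zero, antipodalDual_monicPoly_ne_zero, h2] at h1

theorem chartCoord_multipoleChart_symm (hQ : Q.PosDef) (hv : IsOrthonormalFrame Q v) (hd : 1 ≤ d)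
    {x : (Fin d → ℂ) × ℝ} (hx : x ∈ discRootSet d ×ˢ ({0}ᶜ : Set ℝ)) :
    (multipoleChart hQ hv hd).symm x ∈ MultipoleSpace.chartDomain v d ∧
      MultipoleSpace.chartCoord v d ((multipoleChart hQ hv hd).symm x) = x := by
  rw [← multipoleChart_target hQ hv hd] at hx
  have h := (multipoleChart hQ hv hd).map_target hx
  rw [multipoleChart_source] at h
  refine ⟨h, ?_⟩
  rw [← conicMapHomeo_symm_multipoleMap h]
  exact (multipoleChart hQ hv hd).right_inv hx

theorem mem_discRootSet_prod_one {a : Fin d → ℂ} (ha : a ∈ discRootSet d) :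
    (a, (1 : ℝ)) ∈ discRootSet d ×ˢ ({0}ᶜ : Set ℝ) :=
  ⟨ha, one_ne_zero⟩

theorem toSymPower_eq_of_chartCoord (hQ : Q.PosDef) (hv : IsOrthonormalFrame Q v) (hd : 1 ≤ d)
    {m n : MultipoleSpace d} (hm : m ∈ MultipoleSpace.chartDomain v d)
    (hn : n ∈ MultipoleSpace.chartDomain v d)
    (h : (MultipoleSpace.chartCoord v d m).1 = (MultipoleSpace.chartCoord v d n).1) :
    toSymPower d m = toSymPower d n := by
  have hm2 : (MultipoleSpace.chartCoord v d m).2 ≠ 0 := (MultipoleSpace.chartCoord_mem hm).2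
  have hn2 : (MultipoleSpace.chartCoord v d n).2 ≠ 0 := (MultipoleSpace.chartCoord_mem hn).2
  refine (toSymPower_eq_iff hQ hv hd).2 ⟨Units.mk0 _ (div_ne_zero hm2 hn2), ?_⟩
  rw [multipoleMap_eq_conicMap hm, multipoleMap_eq_conicMap hn, Units.val_mk0, ← Prod.mk.eta
    (p := MultipoleSpace.chartCoord v d n), ← conicMap_smul, div_mul_cancel₀ _ hn2, ← h]

/-- The chart of the symmetric power given by an orthonormal frame. -/
def symPowerChart (hQ : Q.PosDef) (hv : IsOrthonormalFrame Q v) (hd : 1 ≤ d) :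
    OpenPartialHomeomorph (SymPower (RealProj 2) d) (Fin d → ℂ) where
  toFun := SymPower.chartCoord v d
  -- The inverse goes through the local section `ν = 1` of the bundle over the chart domain.
  invFun a := toSymPower d ((multipoleChart hQ hv hd).symm (a, 1))
  source := SymPower.chartDomain v d
  target := discRootSet d
  map_source' x hx := by
    obtain ⟨m, rfl⟩ := isQuotientMap_toSymPower.surjective x
    rw [chartCoord_toSymPower]
    exact (MultipoleSpace.chartCoord_mem (toSymPower_mem_chartDomain.1 hx)).1
  map_target' a ha := toSymPower_mem_chartDomain.2
    (chartCoord_multipoleChart_symm hQ hv hd (mem_discRootSet_prod_one ha)).1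
  left_inv' x hx := by
    obtain ⟨m, rfl⟩ := isQuotientMap_toSymPower.surjective x
    have hm := toSymPower_mem_chartDomain.1 hx
    have h := chartCoord_multipoleChart_symm hQ hv hd
      (mem_discRootSet_prod_one (MultipoleSpace.chartCoord_mem hm).1)
    rw [chartCoord_toSymPower]
    exact toSymPower_eq_of_chartCoord hQ hv hd h.1 hm (by rw [h.2])
  right_inv' a ha := by
    rw [chartCoord_toSymPower,
      (chartCoord_multipoleChart_symm hQ hv hd (mem_discRootSet_prod_one ha)).2]
  open_source := isOpen_symPower_chartDomain hQ hv hd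
  open_target := isOpen_discRootSet
  continuousOn_toFun := by
    rw [isQuotientMap_toSymPower.continuousOn_isOpen_iff (isOpen_symPower_chartDomain hQ hv hd),
      toSymPower_preimage_chartDomain, ← multipoleChart_source hQ hv hd]
    refine (continuous_fst.comp_continuousOn (multipoleChart hQ hv hd).continuousOn).congr
      fun m hm => ?_
    rw [multipoleChart_source] at hm
    rw [Function.comp_apply, chartCoord_toSymPower, ← conicMapHomeo_symm_multipoleMap hm]
    rfl
  continuousOn_invFun := by
    refine isQuotientMap_toSymPower.continuous.comp_continuousOn
      ((multipoleChart hQ hv hd).continuousOn_symm.comp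
        (by fun_prop : Continuous fun a : Fin d → ℂ => (a, (1 : ℝ))).continuousOn fun a ha => ?_)
    rw [multipoleChart_target]
    exact mem_discRootSet_prod_one ha

theorem SymPower.exists_mem_chartDomain (hQ : Q.PosDef) (x : SymPower (RealProj 2) d) :
    ∃ v, IsOrthonormalFrame Q v ∧ x ∈ SymPower.chartDomain v d := by
  obtain ⟨m, rfl⟩ := isQuotientMap_toSymPower.surjective x
  obtain ⟨v, hv, hm⟩ := m.exists_mem_chartDomain hQ
  exact ⟨v, hv, toSymPower_mem_chartDomain.2 hm⟩

/-- The symmetric power of `ℝP²` with the atlas defined by a positive definite form. -/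
@[reducible]
def symPowerChartedSpace (hQ : Q.PosDef) (hd : 1 ≤ d) :
    ChartedSpace (Fin d → ℂ) (SymPower (RealProj 2) d) where
  atlas := SymPower.conicAtlas Q d
  chartAt x := symPowerChart hQ (x.exists_mem_chartDomain hQ).choose_spec.1 hd
  mem_chart_source x := (x.exists_mem_chartDomain hQ).choose_spec.2
  chart_mem_atlas x := ⟨_, (x.exists_mem_chartDomain hQ).choose_spec.1, rfl, fun _ _ => rfl⟩

/-- A chart of the atlas of the symmetric power has a lift to the multipole space on which the
multipole map for the same frame is `conicMap`. -/
theorem exists_lift_chart_symm (hQ : Q.PosDef) (hv : IsOrthonormalFrame Q v) (hd : 1 ≤ d)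
    {e : OpenPartialHomeomorph (SymPower (RealProj 2) d) (Fin d → ℂ)}
    (hs : e.source = SymPower.chartDomain v d)
    (he : Set.EqOn e (SymPower.chartCoord v d) e.source) {a : Fin d → ℂ} (ha : a ∈ e.target) :
    ∃ m, toSymPower d m = e.symm a ∧ multipoleMap v d m = conicMap d (a, 1) := by
  have h1 := e.map_target ha
  have h2 : SymPower.chartCoord v d (e.symm a) = a := by rw [← he h1, e.right_inv ha]
  rw [hs] at h1
  have ha' : a ∈ discRootSet d := h2 ▸ (symPowerChart hQ hv hd).map_source h1
  obtain ⟨h3, h4⟩ := chartCoord_multipoleChart_symm hQ hv hd (mem_discRootSet_prod_one ha')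
  refine ⟨(multipoleChart hQ hv hd).symm (a, 1), ?_, ?_⟩
  · refine (symPowerChart hQ hv hd).injOn (toSymPower_mem_chartDomain.2 h3) h1 ?_
    change SymPower.chartCoord v d _ = SymPower.chartCoord v d _
    rw [h2, chartCoord_toSymPower, h4]
  · rw [multipoleMap_eq_conicMap h3, h4]

/-- Lift along the section `ν = 1`, change charts in the multipole space, and forget the new `ν`. -/
theorem isManifold_symPowerChartedSpace (hQ : Q.PosDef) (hd : 1 ≤ d) :
    letI := symPowerChartedSpace hQ hd
    IsManifold 𝓘(ℝ, Fin d → ℂ) ∞ (SymPower (RealProj 2) d) := by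
  let _ := symPowerChartedSpace hQ hd
  refine isManifold_of_contDiffOn _ _ _ ?_
  rintro e e' ⟨v, hv, hs, he⟩ ⟨v', hv', hs', he'⟩
  obtain ⟨T, hT⟩ := hv.exists_changeFrame hv' d
  simp only [modelWithCornersSelf_coe, modelWithCornersSelf_coe_symm, Function.comp_id,
    Function.id_comp, Set.range_id, Set.preimage_id, Set.inter_univ]
  have key : ∀ a ∈ (e.symm ≫ₕ e').source, T (conicMap d (a, 1)) ∈ (conicMapHomeo d).target ∧
      e' (e.symm a) = ((conicMapHomeo d).symm (T (conicMap d (a, 1)))).1 := by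
    intro a ha
    have ha1 : a ∈ e.target := ha.1
    have ha2 : e.symm a ∈ e'.source := ha.2
    obtain ⟨m, hm, hm'⟩ := exists_lift_chart_symm hQ hv hd hs he ha1
    have hm2 : m ∈ MultipoleSpace.chartDomain v' d := by
      rw [← toSymPower_mem_chartDomain, hm, ← hs']
      exact ha2
    rw [he' ha2, ← hm, chartCoord_toSymPower, ← hm', ← hT, conicMapHomeo_symm_multipoleMap hm2]
    exact ⟨(hv'.mem_chartDomain_iff hQ hd _).1 hm2, rfl⟩
  intro a ha
  have hcd : ContDiffAt ℝ ∞ (fun a => ((conicMapHomeo d).symm (T (conicMap d (a, 1)))).1) a :=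
    contDiffAt_fst.comp a (ContDiffAt.comp a (contDiffAt_conicMapHomeo_symm (key a ha).1)
      (T.contDiff.comp (contDiff_conicMap.comp (contDiff_prodMk_left (1 : ℝ)))).contDiffAt)
  exact hcd.contDiffWithinAt.congr (fun z hz => (key z hz).2) (key a ha).2

/-! ### The symmetric power is a projective space -/

/-- The target of the multipole map as a coordinate space. -/
def antipodalEquivPi (d : ℕ) : ((Fin d → ℂ) × ℝ) ≃L[ℝ] (Fin (2 * d + 1) → ℝ) :=
  ContinuousLinearEquiv.ofFinrankEq (by
    simp [Module.finrank_pi_fintype, Complex.finrank_real_complex, mul_comm])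

theorem IsOrthonormalFrame.antipodalEquivPi_ne_zero (hv : IsOrthonormalFrame Q v)
    (m : MultipoleSpace d) : antipodalEquivPi d (multipoleMap v d m) ≠ 0 := by
  simpa using hv.multipoleMap_ne_zero m

/-- The point of projective space given by a multipole. -/
def multipoleProj (hv : IsOrthonormalFrame Q v) (m : MultipoleSpace d) : RealProj (2 * d) :=
  Projectivization.mk ℝ _ (hv.antipodalEquivPi_ne_zero m)

theorem multipoleProj_eq_iff (hQ : Q.PosDef) (hv : IsOrthonormalFrame Q v) (hd : 1 ≤ d)
    {m n : MultipoleSpace d} :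
    multipoleProj hv m = multipoleProj hv n ↔ toSymPower d m = toSymPower d n := by
  rw [toSymPower_eq_iff hQ hv hd, multipoleProj, multipoleProj, Projectivization.mk_eq_mk_iff]
  refine exists_congr fun t => ?_
  rw [Units.smul_def, ← map_smul, (antipodalEquivPi d).injective.eq_iff, eq_comm]

theorem multipoleProj_homeo_symm (hQ : Q.PosDef) (hv : IsOrthonormalFrame Q v) (hd : 1 ≤ d)
    {x : Fin (2 * d + 1) → ℝ} (hx : x ≠ 0) :
    multipoleProj hv ((multipoleHomeo hQ hv hd).symm ((antipodalEquivPi d).symm x)) =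
      Projectivization.mk ℝ x hx := by
  have h0 : (antipodalEquivPi d).symm x ≠ 0 := by simpa using hx
  simp only [multipoleProj, multipoleMap_multipoleHomeo_symm hQ hv hd h0,
    ContinuousLinearEquiv.apply_symm_apply]

theorem continuous_multipoleProj (hv : IsOrthonormalFrame Q v) :
    Continuous (multipoleProj (d := d) hv) :=
  (Projectivization.isOpenQuotientMap_mk _).continuous.comp
    (((antipodalEquivPi d).continuous.comp continuous_multipoleMap).subtype_mk
      hv.antipodalEquivPi_ne_zero)

/-- The projection of nonzero vectors to projective space factors through this map by way of the
inverse multipole map. -/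
theorem isQuotientMap_multipoleProj (hQ : Q.PosDef) (hv : IsOrthonormalFrame Q v) (hd : 1 ≤ d) :
    IsQuotientMap (multipoleProj (d := d) hv) := by
  let g : {x : Fin (2 * d + 1) → ℝ // x ≠ 0} → MultipoleSpace d :=
    fun x => (multipoleHomeo hQ hv hd).symm ((antipodalEquivPi d).symm x.1)
  have hg : Continuous g := continuous_iff_continuousAt.2 fun x =>
    ContinuousAt.comp (f := fun x : {x : Fin (2 * d + 1) → ℝ // x ≠ 0} =>
      (antipodalEquivPi d).symm x.1)
      (continuousAt_multipoleHomeo_symm hQ hv hd (by simpa using x.2))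
      ((antipodalEquivPi d).symm.continuous.comp continuous_subtype_val).continuousAt
  refine IsQuotientMap.of_comp hg (continuous_multipoleProj hv) ?_
  convert (Projectivization.isOpenQuotientMap_mk (Fin (2 * d + 1) → ℝ)).isQuotientMap using 1
  exact funext fun x => multipoleProj_homeo_symm hQ hv hd x.2

/-- The symmetric power of `ℝP²` is homeomorphic to projective space. -/
def symPowerHomeo (hQ : Q.PosDef) (hv : IsOrthonormalFrame Q v) (hd : 1 ≤ d) :
    SymPower (RealProj 2) d ≃ₜ RealProj (2 * d) :=
  -- Two quotient maps out of the multipole space with the same fibres have homeomorphic targets.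
  have h1 := isQuotientMap_toSymPower (d := d)
  have h2 := isQuotientMap_multipoleProj hQ hv hd
  have key : ∀ m, multipoleProj hv (Function.surjInv h1.surjective (toSymPower d m)) =
      multipoleProj hv m := fun m =>
    (multipoleProj_eq_iff hQ hv hd).2 (Function.surjInv_eq h1.surjective _)
  have key' : ∀ m, toSymPower d (Function.surjInv h2.surjective (multipoleProj hv m)) =
      toSymPower d m := fun m =>
    (multipoleProj_eq_iff hQ hv hd).1 (Function.surjInv_eq h2.surjective _)
  { toFun := fun x => multipoleProj hv (Function.surjInv h1.surjective x)
    invFun := fun p => toSymPower d (Function.surjInv h2.surjective p)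
    left_inv := fun x => by
      exact (key' _).trans (Function.surjInv_eq h1.surjective x)
    right_inv := fun p => by
      exact (key _).trans (Function.surjInv_eq h2.surjective p)
    continuous_toFun := h1.continuous_iff.2
      ((continuous_multipoleProj hv).congr fun m => (key m).symm)
    continuous_invFun := h2.continuous_iff.2 (h1.continuous.congr fun m => (key' m).symm) }

theorem symPowerHomeo_toSymPower (hQ : Q.PosDef) (hv : IsOrthonormalFrame Q v) (hd : 1 ≤ d)
    (m : MultipoleSpace d) : symPowerHomeo hQ hv hd (toSymPower d m) = multipoleProj hv m :=
  (multipoleProj_eq_iff hQ hv hd).2 (Function.surjInv_eq isQuotientMap_toSymPower.surjective _)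

theorem symPowerHomeo_symm_mk (hQ : Q.PosDef) (hv : IsOrthonormalFrame Q v) (hd : 1 ≤ d)
    {x : Fin (2 * d + 1) → ℝ} (hx : x ≠ 0) :
    (symPowerHomeo hQ hv hd).symm (Projectivization.mk ℝ x hx) =
      toSymPower d ((multipoleHomeo hQ hv hd).symm ((antipodalEquivPi d).symm x)) := by
  rw [Homeomorph.symm_apply_eq, symPowerHomeo_toSymPower, multipoleProj_homeo_symm]

theorem contMDiff_symPowerHomeo (hQ : Q.PosDef) (hv : IsOrthonormalFrame Q v) (hd : 1 ≤ d) :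
    letI := symPowerChartedSpace hQ hd
    letI := RealProj.stdChartedSpace (2 * d)
    ContMDiff 𝓘(ℝ, Fin d → ℂ) 𝓘(ℝ, Fin (2 * d) → ℝ) ∞ (symPowerHomeo hQ hv hd) := by
  let _ := symPowerChartedSpace hQ hd
  let _ := RealProj.stdChartedSpace (2 * d)
  intro x
  rw [contMDiffAt_iff]
  refine ⟨(symPowerHomeo hQ hv hd).continuous.continuousAt, ?_⟩
  simp only [mfld_simps]
  set e := chartAt (Fin d → ℂ) x with he_def
  set φ := chartAt (Fin (2 * d) → ℝ) (symPowerHomeo hQ hv hd x) with hφ_def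
  obtain ⟨v', hv', hs, he⟩ := chart_mem_atlas (Fin d → ℂ) x
  obtain ⟨i, hφs, hφ⟩ := chart_mem_atlas (Fin (2 * d) → ℝ) (symPowerHomeo hQ hv hd x)
  obtain ⟨T, hT⟩ := hv'.exists_changeFrame hv d
  -- Homogeneous coordinates of the image as a smooth function of the chart coordinates; the map
  -- itself divides them by the `i`-th one.
  let G : (Fin d → ℂ) → (Fin (2 * d + 1) → ℝ) :=
    fun a => antipodalEquivPi d (T (conicMap d (a, 1)))
  have hG : ContDiff ℝ ∞ G := (antipodalEquivPi d).contDiff.comp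
    (T.contDiff.comp (contDiff_conicMap.comp (contDiff_prodMk_left (1 : ℝ))))
  have key : ∀ a ∈ e.target, ∃ h0 : G a ≠ 0,
      symPowerHomeo hQ hv hd (e.symm a) = Projectivization.mk ℝ (G a) h0 := by
    intro a ha
    obtain ⟨m, hm, hm'⟩ := exists_lift_chart_symm hQ hv' hd hs he ha
    have hGa : G a = antipodalEquivPi d (multipoleMap v d m) := by rw [hT, hm']
    refine ⟨hGa ▸ hv.antipodalEquivPi_ne_zero m, ?_⟩
    rw [← hm, symPowerHomeo_toSymPower]
    simp only [multipoleProj, hGa]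
  have hex : e x ∈ e.target := mem_chart_target _ x
  have hi : G (e x) i ≠ 0 := by
    obtain ⟨h0, h1⟩ := key _ hex
    rw [← RealProj.mk_mem_affineDomain h0, ← h1, ← hφs,
      e.left_inv (mem_chart_source (Fin d → ℂ) x)]
    exact mem_chart_source _ _
  have hcd := (RealProj.contDiffAt_div i hi).comp (e x) hG.contDiffAt
  refine (hcd.congr_of_eventuallyEq ?_).contDiffWithinAt
  have hopen : ∀ᶠ a in 𝓝 (e x), G a i ≠ 0 :=
    ((continuous_apply i).comp hG.continuous).continuousAt.eventually_ne hi
  filter_upwards [e.open_target.mem_nhds hex, hopen] with a ha hai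
  obtain ⟨h0, h1⟩ := key a ha
  have hmem : symPowerHomeo hQ hv hd (e.symm a) ∈ φ.source := by
    rw [hφs, h1]
    exact (RealProj.mk_mem_affineDomain h0).2 hai
  change φ (symPowerHomeo hQ hv hd (e.symm a)) = _
  rw [hφ hmem, h1, RealProj.affineCoord_mk]
  rfl

theorem contMDiff_symPowerHomeo_symm (hQ : Q.PosDef) (hv : IsOrthonormalFrame Q v) (hd : 1 ≤ d) :
    letI := symPowerChartedSpace hQ hd
    letI := RealProj.stdChartedSpace (2 * d)
    ContMDiff 𝓘(ℝ, Fin (2 * d) → ℝ) 𝓘(ℝ, Fin d → ℂ) ∞ (symPowerHomeo hQ hv hd).symm := by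
  let _ := symPowerChartedSpace hQ hd
  let _ := RealProj.stdChartedSpace (2 * d)
  intro p
  rw [contMDiffAt_iff]
  have hc := (symPowerHomeo hQ hv hd).symm.continuous
  refine ⟨hc.continuousAt, ?_⟩
  simp only [mfld_simps]
  set φ := chartAt (Fin (2 * d) → ℝ) p with hφ_def
  set e := chartAt (Fin d → ℂ) ((symPowerHomeo hQ hv hd).symm p) with he_def
  obtain ⟨i, hφs, hφ⟩ := chart_mem_atlas (Fin (2 * d) → ℝ) p
  obtain ⟨v', hv', hs, he⟩ := chart_mem_atlas (Fin d → ℂ) ((symPowerHomeo hQ hv hd).symm p)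
  obtain ⟨T, hT⟩ := hv.exists_changeFrame hv' d
  -- The polynomial of the point in the frame `v'`. Applying `conicMap⁻¹` and dropping `ν` yields
  -- the chart coordinates.
  let G : (Fin (2 * d) → ℝ) → (Fin d → ℂ) × ℝ :=
    fun y => T ((antipodalEquivPi d).symm (RealProj.homogCoord i y))
  have hG : ContDiff ℝ ∞ G := T.contDiff.comp
    ((antipodalEquivPi d).symm.contDiff.comp (RealProj.contDiff_homogCoord i))
  have key : ∀ y ∈ φ.target, (symPowerHomeo hQ hv hd).symm (φ.symm y) ∈ e.source →
      G y ∈ (conicMapHomeo d).target ∧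
        e ((symPowerHomeo hQ hv hd).symm (φ.symm y)) = ((conicMapHomeo d).symm (G y)).1 := by
    intro y hy hye
    have h0 : (antipodalEquivPi d).symm (RealProj.homogCoord i y) ≠ 0 := by
      simpa using RealProj.homogCoord_ne_zero i y
    rw [he hye]
    rw [hs] at hye
    rw [RealProj.symm_of_mem_stdAtlas hφs hφ hy, symPowerHomeo_symm_mk] at hye ⊢
    rw [toSymPower_mem_chartDomain] at hye
    have hGy : G y = multipoleMap v' d ((multipoleHomeo hQ hv hd).symm
        ((antipodalEquivPi d).symm (RealProj.homogCoord i y))) := by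
      rw [hT, multipoleMap_multipoleHomeo_symm hQ hv hd h0]
    rw [hGy, chartCoord_toSymPower, conicMapHomeo_symm_multipoleMap hye]
    exact ⟨(hv'.mem_chartDomain_iff hQ hd _).1 hye, rfl⟩
  have hpt : φ p ∈ φ.target := mem_chart_target _ p
  have hps : φ.symm (φ p) = p := φ.left_inv (mem_chart_source _ p)
  have hpe : (symPowerHomeo hQ hv hd).symm (φ.symm (φ p)) ∈ e.source := by
    rw [hps]
    exact mem_chart_source _ _
  have hcd : ContDiffAt ℝ ∞ (fun y => ((conicMapHomeo d).symm (G y)).1) (φ p) :=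
    contDiffAt_fst.comp _ (ContDiffAt.comp _ (contDiffAt_conicMapHomeo_symm (key _ hpt hpe).1)
      hG.contDiffAt)
  refine (hcd.congr_of_eventuallyEq ?_).contDiffWithinAt
  have hcont : ContinuousAt (fun y => (symPowerHomeo hQ hv hd).symm (φ.symm y)) (φ p) :=
    hc.continuousAt.comp (φ.continuousAt_symm hpt)
  filter_upwards [φ.open_target.mem_nhds hpt,
    hcont.preimage_mem_nhds (e.open_source.mem_nhds hpe)] with y hy hye
  exact (key y hy hye).2

end symPower

end

/-! ### The three identifications assembled -/

theorem corollary15 (Q : QuadraticForm ℝ (Fin 3 → ℝ)) (hQ : Q.PosDef) (d : ℕ) (hd : 1 ≤ d) :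
    (∃ _ : ChartedSpace ((Fin d → ℂ) × ℝ) (MultipoleSpace d),
      atlas ((Fin d → ℂ) × ℝ) (MultipoleSpace d) = MultipoleSpace.conicAtlas Q d ∧
      IsManifold 𝓘(ℝ, (Fin d → ℂ) × ℝ) ∞ (MultipoleSpace d) ∧
      Nonempty (MultipoleSpace d
        ≃ₘ^∞⟮𝓘(ℝ, (Fin d → ℂ) × ℝ), 𝓘(ℝ, EuclideanSpace ℝ (Fin (2 * d + 1)))⟯
        puncturedSpace (2 * d + 1)) ∧
      Nonempty (MultipoleSpace d
        ≃ₘ^∞⟮𝓘(ℝ, (Fin d → ℂ) × ℝ), (𝓡 (2 * d)).prod 𝓘(ℝ, ℝ)⟯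
        (Metric.sphere (0 : EuclideanSpace ℝ (Fin (2 * d + 1))) 1 × ℝ))) ∧
    Nonempty (ConedMultipoleSpace d ≃ₜ EuclideanSpace ℝ (Fin (2 * d + 1))) ∧
    (∃ (_ : ChartedSpace (Fin d → ℂ) (SymPower (RealProj 2) d))
      (_ : ChartedSpace (Fin (2 * d) → ℝ) (RealProj (2 * d))),
      atlas (Fin d → ℂ) (SymPower (RealProj 2) d) = SymPower.conicAtlas Q d ∧
      atlas (Fin (2 * d) → ℝ) (RealProj (2 * d)) = RealProj.stdAtlas (2 * d) ∧
      IsManifold 𝓘(ℝ, Fin d → ℂ) ∞ (SymPower (RealProj 2) d) ∧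
      IsManifold 𝓘(ℝ, Fin (2 * d) → ℝ) ∞ (RealProj (2 * d)) ∧
      Nonempty (SymPower (RealProj 2) d
        ≃ₘ^∞⟮𝓘(ℝ, Fin d → ℂ), 𝓘(ℝ, Fin (2 * d) → ℝ)⟯ RealProj (2 * d))) := by
  -- Any frame will do, since the atlases involve all of them; the empty family imposes no
  -- condition.
  obtain ⟨v, hv, -⟩ := exists_isOrthonormalFrame hQ (Fin.elim0 : Fin 0 → LinForm)
  refine ⟨⟨multipoleChartedSpace hQ hd, rfl, isManifold_multipoleChartedSpace hQ hd,
    ⟨multipoleDiffeoPunctured hQ hv hd⟩, ⟨multipoleDiffeoSphere hQ hv hd⟩⟩,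
    ⟨(isHomeomorph_conedMap hQ hv hd).homeomorph.trans
      (antipodalEquivEuclidean d).toHomeomorph⟩,
    symPowerChartedSpace hQ hd, RealProj.stdChartedSpace (2 * d), rfl, rfl,
    isManifold_symPowerChartedSpace hQ hd, RealProj.isManifold_stdChartedSpace (2 * d), ⟨?_⟩⟩
  let _ := symPowerChartedSpace hQ hd
  let _ := RealProj.stdChartedSpace (2 * d)
  exact
    { toEquiv := (symPowerHomeo hQ hv hd).toEquiv
      contMDiff_toFun := contMDiff_symPowerHomeo hQ hv hd
      contMDiff_invFun := contMDiff_symPowerHomeo_symm hQ hv hd }
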